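/- Let $p>0$ be a constant. For every integer $N\ge 1$ and all real numbers $k_1,\dots,k_N$ there exist constants $Q,\sigma>0$ (depending only on $p$, $N$ and $k_1,\dots,k_N$) such that the following holds, where $k(x)=\sum_{n=1}^N k_n\sqrt2\,\sin(n\pi x)$ for $x\in[0,1]$ and $u[t]$ denotes the profile $x\mapsto u(t,x)$. For every $u_0\in L^2(0,1)$ the initial-boundary value problem $$\frac{\partial u}{\partial t}(t,x)=p\,\frac{\partial^2u}{\partial x^2}(t,x)\quad (t>0,\ x\in(0,1)),$$ $$u(t,0)=0,\qquad u(t,1)=\int_0^1k(s)\,u(t,s)\,ds\quad (t>0),\qquad u[0]=u_0\ \text{ in } L^2(0,1),$$ has a solution $u\in C^0([0,+\infty);L^2(0,1))\cap C^1((0,+\infty)\times[0,1])$ with $u[t]\in C^2([0,1])$ for every $t>0$. This solution is unique in this class (any two such solutions coincide at every point of $(0,+\infty)\times[0,1]$, and as elements of $L^2(0,1)$ for every $t\ge0$), and it satisfies $$\|u[t]\|\le Q\,e^{\sigma t}\,\|u_0\|\quad\text{for all } t\ge 0,$$ where $\|\cdot\|$ is the norm of $L^2(0,1)$. -/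

import Mathlib

open Set MeasureTheory
open scoped NNReal

noncomputable section

namespace HeatFeedback

/-- The real Hilbert space `L²(0,1)` (equivalence classes, Lebesgue measure), with its norm
`‖f‖ = (∫₀¹ |f|²)^(1/2)`. -/
abbrev L2 : Type := Lp ℝ 2 (volume.restrict (Ioo (0 : ℝ) 1))

/-- The sine functions `φₙ(x) = √2 sin(nπx)`, for `n = 1, 2, …`. -/
def phi (n : ℕ) (x : ℝ) : ℝ := Real.sqrt 2 * Real.sin (n * Real.pi * x)

/-- The feedback kernel `k(x) = k₁ φ₁(x) + ⋯ + k_N φ_N(x)`; the coefficient `k_{i+1}` is `κ i`. -/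
def kernel {N : ℕ} (κ : Fin N → ℝ) (x : ℝ) : ℝ := ∑ i : Fin N, κ i * phi ((i : ℕ) + 1) x

/-- `u` is a solution, with initial condition `u[0] = u₀` in `L²(0,1)`, of the heat equation
`u_t = p u_xx` on `(0,∞) × (0,1)` with boundary conditions `u(t,0) = 0` and
`u(t,1) = ∫₀¹ k(s) u(t,s) ds` for `t > 0`.
The pair `(u, U)` consists of the function `u` and of the continuous curve `t ↦ U t` in `L²(0,1)`
of the classes of its profiles `u[t] = u(t, ·)`.  Only the values `u t x` with `t ≥ 0` and
`x ∈ [0,1]` matter. -/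
structure IsSolution (p : ℝ) (k : ℝ → ℝ) (u₀ : L2) (u : ℝ → ℝ → ℝ) (U : C(ℝ≥0, L2)) : Prop where
  /-- `U t` is the class of the profile `u[t]`; so `u` is in `C⁰(ℝ₊; L²(0,1))`. -/
  profile : ∀ t : ℝ≥0, U t =ᵐ[volume.restrict (Ioo (0 : ℝ) 1)] u t
  /-- `u` is in `C¹((0,∞) × [0,1])`. -/
  contDiffOn_one : ContDiffOn ℝ 1 (fun z : ℝ × ℝ => u z.1 z.2) (Ioi 0 ×ˢ Icc 0 1)
  /-- `u[t]` is in `C²([0,1])` for `t > 0`. -/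
  contDiffOn_two : ∀ t : ℝ, 0 < t → ContDiffOn ℝ 2 (u t) (Icc 0 1)
  heat : ∀ t : ℝ, 0 < t → ∀ x ∈ Ioo (0 : ℝ) 1,
    deriv (fun s => u s x) t = p * deriv (deriv (u t)) x
  left_bc : ∀ t : ℝ, 0 < t → u t 0 = 0
  right_bc : ∀ t : ℝ, 0 < t → u t 1 = ∫ s in (0 : ℝ)..1, k s * u t s
  initial : U 0 = u₀

end HeatFeedback

end

noncomputable section

namespace HeatFeedback

/-! The kernel is a combination of the first `N` sines, so the feedback sees only the first `N` sine
coordinates of `u[t]`. Integrating by parts against `phi (n + 1)` (`hasDerivAt_sineCoeff`) shows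
that each coordinate satisfies a scalar linear equation driven by the boundary value `u(t,1)`. Under
the feedback law that value is a linear form in the first `N` coordinates, so these satisfy a closed
system `y' = A y` with `A = modalOp p κ`.

Uniqueness: the first `N` coordinates of two solutions agree by uniqueness for this system, hence so
do their boundary values. Every other coordinate then agrees by a scalar equation, and completeness
of the sines (`eq_zero_of_inner_sineL2`) concludes.

Existence: the boundary value is known in advance, namely the smooth function `w(t) = feedback κ
(exp(tA) a)`, where `a` holds the first `N` coordinates of `u₀`. It remains to solve the heat
equation with prescribed data `w` (`exists_isHeatCurve`). Subtracting the lift `w x + w' (x³ -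
x)/(6p)` leaves a homogeneous Dirichlet problem with source `-w'' (x³ - x)/(6p)`. The cubic vanishes
at both ends, so its sine coefficients decay fast, and Duhamel's formula gains two more powers of
`n`; the modes are `O(n⁻⁴)` for `t` away from `0`, and the series can be differentiated term by
term. The coordinates of the function obtained solve the same scalar equations as `y`, so the
feedback condition holds. The estimate follows from the exponential bound on `w`, `w'`, `w''`. -/

/-! ### Completeness of the sine system in `L²(0,1)`. -/

lemma memLp_of_continuousOn {f : ℝ → ℝ} (hf : ContinuousOn f (Icc 0 1)) :
    MemLp f 2 (volume.restrict (Ioo (0 : ℝ) 1)) := by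
  obtain ⟨C, hC⟩ := isCompact_Icc.exists_bound_of_continuousOn hf
  refine MemLp.of_bound ((hf.mono Ioo_subset_Icc_self).aestronglyMeasurable measurableSet_Ioo) C ?_
  filter_upwards [ae_restrict_mem measurableSet_Ioo] with x hx
  exact hC x (Ioo_subset_Icc_self hx)

/-- The class in `L²(0,1)` of a function which is continuous on `[0,1]`. -/
def toL2 (f : ℝ → ℝ) (hf : ContinuousOn f (Icc 0 1)) : L2 := (memLp_of_continuousOn hf).toLp f

lemma coeFn_toL2 (f : ℝ → ℝ) (hf : ContinuousOn f (Icc 0 1)) :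
    toL2 f hf =ᵐ[volume.restrict (Ioo (0 : ℝ) 1)] f := MemLp.coeFn_toLp _

lemma integral_Ioo_eq (f : ℝ → ℝ) : ∫ x in Ioo (0 : ℝ) 1, f x = ∫ x in (0 : ℝ)..1, f x := by
  rw [intervalIntegral.integral_of_le zero_le_one, integral_Ioc_eq_integral_Ioo]

lemma inner_toL2 (f : ℝ → ℝ) (hf : ContinuousOn f (Icc 0 1)) (g : L2) :
    inner ℝ (toL2 f hf) g = ∫ x in (0 : ℝ)..1, f x * g x := by
  rw [L2.inner_def, ← integral_Ioo_eq]
  refine integral_congr_ae ?_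
  filter_upwards [coeFn_toL2 f hf] with x hx
  simp [hx, mul_comm]

lemma integrable_mul_L2 {g : ℝ → ℝ} (hg : ContinuousOn g (Icc 0 1)) (f : L2) :
    Integrable (fun x => g x * f x) (volume.restrict (Ioo (0 : ℝ) 1)) :=
  (memLp_of_continuousOn hg).integrable_mul (Lp.memLp f)

@[fun_prop]
lemma continuous_phi (n : ℕ) : Continuous (phi n) := by
  unfold phi; fun_prop

/-- The class of `phi (n + 1)` in `L²(0,1)`. -/
def sineL2 (n : ℕ) : L2 := toL2 (phi (n + 1)) (continuous_phi _).continuousOn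

lemma integral_cos_int_mul_pi (k : ℤ) :
    ∫ x in (0 : ℝ)..1, Real.cos (k * Real.pi * x) = if k = 0 then 1 else 0 := by
  split_ifs with h
  · simp [h]
  · have h2 : (k * Real.pi : ℝ) ≠ 0 := by positivity
    rw [intervalIntegral.integral_comp_mul_left (fun x => Real.cos x) h2]
    simp [Real.sin_int_mul_pi]

lemma integral_phi_mul_phi (m n : ℕ) :
    ∫ x in (0 : ℝ)..1, phi (m + 1) x * phi (n + 1) x = if m = n then 1 else 0 := by
  have h : ∀ x : ℝ, phi (m + 1) x * phi (n + 1) x =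
      Real.cos (((m - n : ℤ) : ℝ) * Real.pi * x)
        - Real.cos (((m + n + 2 : ℤ) : ℝ) * Real.pi * x) := by
    intro x
    have e1 : (((m - n : ℤ) : ℝ) * Real.pi * x) =
      (m + 1) * Real.pi * x - (n + 1) * Real.pi * x := by push_cast; ring
    have e2 : (((m + n + 2 : ℤ) : ℝ) * Real.pi * x) =
      (m + 1) * Real.pi * x + (n + 1) * Real.pi * x := by push_cast; ring
    rw [e1, e2, Real.cos_sub, Real.cos_add]
    unfold phi
    push_cast
    linear_combination (Real.sin ((m + 1) * Real.pi * x) * Real.sin ((n + 1) * Real.pi * x)) *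
      Real.mul_self_sqrt (zero_le_two (α := ℝ))
  simp_rw [h]
  rw [intervalIntegral.integral_sub, integral_cos_int_mul_pi, integral_cos_int_mul_pi]
  · have : (m : ℤ) + n + 2 ≠ 0 := by positivity
    simp [this, sub_eq_zero]
  all_goals exact Continuous.intervalIntegrable (by fun_prop) _ _

lemma orthonormal_sineL2 : Orthonormal ℝ sineL2 := by
  rw [orthonormal_iff_ite]
  intro m n
  rw [sineL2, inner_toL2, ← integral_phi_mul_phi m n, ← integral_Ioo_eq, ← integral_Ioo_eq]
  refine integral_congr_ae ?_
  filter_upwards [coeFn_toL2 (phi (n + 1)) (continuous_phi _).continuousOn] with x hx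
  simp [sineL2, hx]

/-- The identity `2 cos(πx) sin((n+1)πx) = sin((n+2)πx) + sin(nπx)` removes one power of the cosine,
at the price of changing `n`; hence the induction on `j` for all `n`. -/
lemma integral_cos_pow_mul_sin (f : L2)
    (hf : ∀ n : ℕ, ∫ x in Ioo (0 : ℝ) 1, Real.sin (n * Real.pi * x) * f x = 0) (j n : ℕ) :
    ∫ x in Ioo (0 : ℝ) 1, (Real.cos (Real.pi * x) ^ j * Real.sin (n * Real.pi * x)) * f x = 0 := by
  induction j generalizing n with
  | zero => simpa using hf n
  | succ j ih =>
    rcases n with _ | n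
    · simp
    have h : ∀ x : ℝ, (Real.cos (Real.pi * x) ^ (j + 1) *
        Real.sin ((n + 1 : ℕ) * Real.pi * x)) * f x =
        2⁻¹ * ((Real.cos (Real.pi * x) ^ j * Real.sin ((n + 2 : ℕ) * Real.pi * x)) * f x
        + (Real.cos (Real.pi * x) ^ j * Real.sin (n * Real.pi * x)) * f x) := by
      intro x
      have e1 : ((n + 2 : ℕ) : ℝ) * Real.pi * x = (n + 1 : ℕ) * Real.pi * x + Real.pi * x := by
        push_cast; ring
      have e2 : (n : ℝ) * Real.pi * x = (n + 1 : ℕ) * Real.pi * x - Real.pi * x := by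
        push_cast; ring
      rw [e1, e2, Real.sin_add, Real.sin_sub]
      ring
    simp_rw [h]
    rw [integral_const_mul, integral_add, ih, ih]
    · simp
    · exact integrable_mul_L2 (Continuous.continuousOn (by fun_prop)) f
    · exact integrable_mul_L2 (Continuous.continuousOn (by fun_prop)) f

lemma integral_polynomial_cos_mul_sin (f : L2)
    (hf : ∀ n : ℕ, ∫ x in Ioo (0 : ℝ) 1, Real.sin (n * Real.pi * x) * f x = 0)
    (q : Polynomial ℝ) :
    ∫ x in Ioo (0 : ℝ) 1, (q.eval (Real.cos (Real.pi * x)) * Real.sin (Real.pi * x)) * f x = 0 := by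
  induction q using Polynomial.induction_on' with
  | add q r hq hr =>
    simp_rw [Polynomial.eval_add, add_mul]
    rw [integral_add, hq, hr, add_zero]
    · exact integrable_mul_L2 (Continuous.continuousOn (by fun_prop)) f
    · exact integrable_mul_L2 (Continuous.continuousOn (by fun_prop)) f
  | monomial j a =>
    have h := integral_cos_pow_mul_sin f hf j 1
    simp_rw [Polynomial.eval_monomial, mul_assoc]
    rw [integral_const_mul]
    simp only [Nat.cast_one, one_mul, mul_assoc] at h
    rw [h, mul_zero]

lemma integral_continuous_mul_sin (f : L2)
    (hf : ∀ n : ℕ, ∫ x in Ioo (0 : ℝ) 1, Real.sin (n * Real.pi * x) * f x = 0)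
    (g : ℝ → ℝ) (hg : Continuous g) :
    ∫ x in Ioo (0 : ℝ) 1, (g x * Real.sin (Real.pi * x)) * f x = 0 := by
  set I : ℝ := ∫ x in Ioo (0 : ℝ) 1, |f x|
  have hI0 : 0 ≤ I := integral_nonneg fun x => abs_nonneg _
  have hfi : Integrable f (volume.restrict (Ioo (0 : ℝ) 1)) := by
    simpa using integrable_mul_L2 (g := fun _ => 1) continuousOn_const f
  have key : ∀ ε > 0, |∫ x in Ioo (0 : ℝ) 1, (g x * Real.sin (Real.pi * x)) * f x| ≤ ε * I := by
    intro ε hε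
    -- Weierstrass in the variable `y = cos(πx)`: on `(0,1)` the change of variable is inverted by
    -- `x = arccos y / π`.
    obtain ⟨q, hq⟩ := exists_polynomial_near_of_continuousOn (-1) 1
      (fun y => g (Real.arccos y / Real.pi)) (by fun_prop) ε hε
    have hz := integral_polynomial_cos_mul_sin f hf q
    suffices h : |(∫ x in Ioo (0 : ℝ) 1, (g x * Real.sin (Real.pi * x)) * f x) -
        ∫ x in Ioo (0 : ℝ) 1,
          (q.eval (Real.cos (Real.pi * x)) * Real.sin (Real.pi * x)) * f x| ≤ ε * I by
      rwa [hz, sub_zero] at h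
    rw [← integral_sub]
    · rw [show ε * I = ∫ x in Ioo (0 : ℝ) 1, ε * |f x| from (integral_const_mul _ _).symm,
        ← Real.norm_eq_abs]
      refine norm_integral_le_of_norm_le (hfi.abs.const_mul ε) ?_
      filter_upwards [ae_restrict_mem measurableSet_Ioo] with x hx
      have h1 := hq (Real.cos (Real.pi * x)) (Real.cos_mem_Icc _)
      have hp := Real.pi_pos
      rw [Real.arccos_cos (by have := hx.1; positivity) (by nlinarith [hx.2]),
        mul_div_cancel_left₀ _ hp.ne'] at h1
      rw [← sub_mul, ← sub_mul, Real.norm_eq_abs, abs_mul, abs_mul]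
      have h2 : |g x - Polynomial.eval (Real.cos (Real.pi * x)) q| ≤ ε := by
        rw [abs_sub_comm]; exact h1.le
      calc _ ≤ ε * 1 * |f x| := by
            gcongr
            exact Real.abs_sin_le_one _
        _ = _ := by ring
    · exact integrable_mul_L2 (Continuous.continuousOn (by fun_prop)) f
    · exact integrable_mul_L2 (Continuous.continuousOn (by fun_prop)) f
  by_contra hne
  have hpos := abs_pos.2 hne
  set J := |∫ x in Ioo (0 : ℝ) 1, (g x * Real.sin (Real.pi * x)) * f x|
  -- With this `ε`, `ε I < J`; the `+ 1` covers `I = 0`.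
  have := key (J / (2 * (I + 1))) (by positivity)
  rw [div_mul_eq_mul_div, le_div_iff₀ (by positivity)] at this
  nlinarith

/-- The function `sin(πx) f` is orthogonal to all test functions, hence zero almost everywhere, and
`sin(πx) > 0` on `(0,1)`. -/
lemma eq_zero_of_inner_sineL2 (f : L2) (hf : ∀ n, inner ℝ (sineL2 n) f = 0) : f = 0 := by
  have hf' : ∀ n : ℕ, ∫ x in Ioo (0 : ℝ) 1, Real.sin (n * Real.pi * x) * f x = 0 := by
    rintro (_ | n)
    · simp
    have h := hf n
    rw [sineL2, inner_toL2, ← integral_Ioo_eq] at h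
    simp_rw [phi, mul_assoc] at h
    rw [integral_const_mul] at h
    simpa [mul_assoc] using h
  have hfi : Integrable (fun x => Real.sin (Real.pi * x) * f x)
      (volume.restrict (Ioo (0 : ℝ) 1)) :=
    integrable_mul_L2 (Continuous.continuousOn (by fun_prop)) f
  have h0 : ∀ᵐ x : ℝ, x ∈ Ioo (0 : ℝ) 1 → Real.sin (Real.pi * x) * f x = 0 := by
    refine isOpen_Ioo.ae_eq_zero_of_integral_contDiff_smul_eq_zero
      (IntegrableOn.locallyIntegrableOn hfi) ?_
    intro g hg _ hgs
    refine Eq.trans ?_ (integral_continuous_mul_sin f hf' g hg.continuous)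
    simp_rw [smul_eq_mul, mul_assoc]
    refine (setIntegral_eq_integral_of_forall_compl_eq_zero fun x hx => ?_).symm
    rw [image_eq_zero_of_notMem_tsupport (fun h => hx (hgs h)), zero_mul]
  rw [Lp.eq_zero_iff_ae_eq_zero, Filter.EventuallyEq, ae_restrict_iff' measurableSet_Ioo]
  filter_upwards [h0] with x hx hx1
  have hs : 0 < Real.sin (Real.pi * x) := by
    have := Real.pi_pos
    exact Real.sin_pos_of_pos_of_lt_pi (by have := hx1.1; positivity) (by nlinarith [hx1.2])
  exact (mul_eq_zero.1 (hx hx1)).resolve_left hs.ne'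

/-- The Hilbert basis of `L²(0,1)` formed by the classes of `phi 1, phi 2, …`. -/
def sineBasis : HilbertBasis ℕ ℝ L2 :=
  HilbertBasis.mkOfOrthogonalEqBot orthonormal_sineL2 <| by
    rw [Submodule.eq_bot_iff]
    intro f hf
    refine eq_zero_of_inner_sineL2 f fun n => ?_
    exact (Submodule.mem_orthogonal _ _).1 hf _ (Submodule.subset_span ⟨n, rfl⟩)

@[simp]
lemma sineBasis_apply (n : ℕ) : sineBasis n = sineL2 n := by
  simp [sineBasis]

lemma inner_sineL2 (n : ℕ) (f : L2) :
    inner ℝ (sineL2 n) f = ∫ x in (0 : ℝ)..1, phi (n + 1) x * f x := inner_toL2 _ _ _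

/-! ### Modal equations for the heat equation. -/

/-- The angular frequency `(n + 1)π` of `phi (n + 1)`. -/
def freq (n : ℕ) : ℝ := (n + 1) * Real.pi

lemma freq_pos (n : ℕ) : 0 < freq n := by unfold freq; positivity

lemma phi_eq (n : ℕ) (x : ℝ) : phi (n + 1) x = Real.sqrt 2 * Real.sin (freq n * x) := by
  simp [phi, freq]

lemma hasDerivAt_phi (n : ℕ) (x : ℝ) :
    HasDerivAt (phi (n + 1)) (Real.sqrt 2 * freq n * Real.cos (freq n * x)) x := by
  have h : HasDerivAt (fun x => Real.sqrt 2 * Real.sin (freq n * x))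
      (Real.sqrt 2 * (Real.cos (freq n * x) * (freq n * 1))) x :=
    (((hasDerivAt_id x).const_mul (freq n)).sin).const_mul _
  rw [show phi (n + 1) = fun x => Real.sqrt 2 * Real.sin (freq n * x) from
    funext (phi_eq n)]
  convert h using 1
  ring

lemma hasDerivAt_phi_deriv (n : ℕ) (x : ℝ) :
    HasDerivAt (fun x => Real.sqrt 2 * freq n * Real.cos (freq n * x))
      (-(freq n ^ 2 * phi (n + 1) x)) x := by
  have h : HasDerivAt (fun x => Real.sqrt 2 * freq n * Real.cos (freq n * x))
      (Real.sqrt 2 * freq n * (-Real.sin (freq n * x) * (freq n * 1))) x :=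
    (((hasDerivAt_id x).const_mul (freq n)).cos).const_mul _
  convert h using 1
  rw [phi_eq]
  ring

@[simp] lemma phi_zero (n : ℕ) : phi n 0 = 0 := by simp [phi]

@[simp] lemma phi_one (n : ℕ) : phi n 1 = 0 := by simp [phi]

lemma cos_freq (n : ℕ) : Real.cos (freq n) = -(-1) ^ n := by
  have := Real.cos_nat_mul_pi (n + 1)
  rw [freq]
  push_cast at this
  rw [this, pow_succ]
  ring

/-- Green's identity: `φ y' - φ' y` is an antiderivative of `φ y'' - φ'' y`. As `φ` vanishes at both
ends and `y 0 = 0`, only `φ'(1) y(1)` survives, with `cos (freq n) = -(-1)ⁿ`. -/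
lemma integral_phi_mul_deriv_deriv {y : ℝ → ℝ} (hy : ContDiffOn ℝ 2 y (Icc 0 1)) (hy0 : y 0 = 0)
    (n : ℕ) :
    ∫ x in (0 : ℝ)..1, phi (n + 1) x * deriv (deriv y) x =
      -(freq n ^ 2) * (∫ x in (0 : ℝ)..1, phi (n + 1) x * y x)
        + Real.sqrt 2 * freq n * (-1) ^ n * y 1 := by
  have hu : UniqueDiffOn ℝ (Icc (0 : ℝ) 1) := uniqueDiffOn_Icc zero_lt_one
  -- One-sided derivatives are continuous up to the endpoints, where `deriv` carries no information;
  -- the two agree on the open interval.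
  set y1 := derivWithin y (Icc 0 1) with hy1
  set y2 := derivWithin y1 (Icc 0 1) with hy2
  have c1 : ContDiffOn ℝ 1 y1 (Icc 0 1) := hy.derivWithin hu (by norm_num)
  have c2 : ContinuousOn y2 (Icc 0 1) := c1.continuousOn_derivWithin hu le_rfl
  have d1 : ∀ x ∈ Ioo (0 : ℝ) 1, HasDerivAt y (y1 x) x := fun x hx =>
    ((hy.differentiableOn (by norm_num) x (Ioo_subset_Icc_self hx)).hasDerivWithinAt).hasDerivAt
      (Icc_mem_nhds hx.1 hx.2)
  have d2 : ∀ x ∈ Ioo (0 : ℝ) 1, HasDerivAt y1 (y2 x) x := fun x hx =>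
    ((c1.differentiableOn (by norm_num) x (Ioo_subset_Icc_self hx)).hasDerivWithinAt).hasDerivAt
      (Icc_mem_nhds hx.1 hx.2)
  have dd : ∀ x ∈ Ioo (0 : ℝ) 1, deriv (deriv y) x = y2 x := by
    intro x hx
    have : deriv y =ᶠ[nhds x] y1 := by
      filter_upwards [isOpen_Ioo.mem_nhds hx] with z hz using (d1 z hz).deriv
    rw [this.deriv_eq, (d2 x hx).deriv]
  have e1 : ∫ x in (0 : ℝ)..1, phi (n + 1) x * deriv (deriv y) x =
      ∫ x in (0 : ℝ)..1, phi (n + 1) x * y2 x := by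
    rw [← integral_Ioo_eq, ← integral_Ioo_eq]
    exact setIntegral_congr_fun measurableSet_Ioo fun x hx => by simp only [dd x hx]
  have hcy := hy.continuousOn
  have i2 : IntervalIntegrable (fun x => phi (n + 1) x * y2 x) volume 0 1 := by
    refine ContinuousOn.intervalIntegrable ?_
    rw [uIcc_of_le zero_le_one]
    fun_prop
  have i0 : IntervalIntegrable (fun x => phi (n + 1) x * y x) volume 0 1 := by
    refine ContinuousOn.intervalIntegrable ?_
    rw [uIcc_of_le zero_le_one]
    fun_prop
  have key := intervalIntegral.integral_eq_sub_of_hasDerivAt_of_le (zero_le_one (α := ℝ))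
    (f := fun x => phi (n + 1) x * y1 x - Real.sqrt 2 * freq n * Real.cos (freq n * x) * y x)
    (f' := fun x => phi (n + 1) x * y2 x + freq n ^ 2 * (phi (n + 1) x * y x))
    (by have := c1.continuousOn; fun_prop)
    (by
      intro x hx
      have := ((hasDerivAt_phi n x).mul (d2 x hx)).sub ((hasDerivAt_phi_deriv n x).mul (d1 x hx))
      exact this.congr_deriv (by ring))
    (i2.add (i0.const_mul _))
  rw [intervalIntegral.integral_add i2 (i0.const_mul _), intervalIntegral.integral_const_mul] at key
  simp only [phi_one, phi_zero, hy0, mul_one, cos_freq] at key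
  rw [e1]
  linear_combination key

lemma hasDerivAt_integral_phi_mul {v : ℝ → ℝ → ℝ}
    (h1 : ContDiffOn ℝ 1 (fun z : ℝ × ℝ => v z.1 z.2) (Ioi 0 ×ˢ Icc 0 1)) (n : ℕ) {t : ℝ}
    (ht : 0 < t) :
    HasDerivAt (fun s => ∫ x in (0 : ℝ)..1, phi (n + 1) x * v s x)
      (∫ x in (0 : ℝ)..1, phi (n + 1) x * deriv (fun s => v s x) t) t := by
  set S : Set (ℝ × ℝ) := Ioi 0 ×ˢ Icc 0 1
  have hS : UniqueDiffOn ℝ S := (isOpen_Ioi.uniqueDiffOn).prod (uniqueDiffOn_Icc zero_lt_one)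
  set G : ℝ × ℝ → ℝ := fun z => fderivWithin ℝ (fun z : ℝ × ℝ => v z.1 z.2) S z (1, 0)
  have hG : ContinuousOn G S :=
    (h1.continuousOn_fderivWithin hS le_rfl).clm_apply continuousOn_const
  have hd : ∀ s : ℝ, 0 < s → ∀ x ∈ Icc (0 : ℝ) 1, HasDerivAt (fun s => v s x) (G (s, x)) s := by
    intro s hs x hx
    have hm : (s, x) ∈ S := ⟨hs, hx⟩
    have hf := (h1.differentiableOn one_ne_zero _ hm).hasFDerivWithinAt
    have hc : HasDerivWithinAt (fun s : ℝ => (s, x)) ((1 : ℝ), (0 : ℝ)) (Ioi 0) s :=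
      ((hasDerivAt_id s).prodMk (hasDerivAt_const s x)).hasDerivWithinAt
    have hmap : MapsTo (fun s : ℝ => (s, x)) (Ioi 0) S := fun r hr => ⟨hr, hx⟩
    exact (hf.comp_hasDerivWithinAt s hc hmap).hasDerivAt (Ioi_mem_nhds hs)
  have hslice : ∀ s : ℝ, 0 < s → ContinuousOn (v s) (Icc 0 1) := fun s hs =>
    h1.continuousOn.comp (f := fun x => (s, x)) (by fun_prop) fun x hx => ⟨hs, hx⟩
  have hGslice : ContinuousOn (fun x => G (t, x)) (Icc 0 1) :=
    hG.comp (f := fun x => (t, x)) (by fun_prop) fun x hx => ⟨ht, hx⟩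
  -- The domination needed to differentiate under the integral: the time derivative is continuous up
  -- to `x = 0` and `x = 1`, so bounded on a compact time window around `t`.
  obtain ⟨C, hC⟩ := (isCompact_Icc.prod isCompact_Icc).exists_bound_of_continuousOn
    (f := fun z : ℝ × ℝ => phi (n + 1) z.2 * G z) (s := Icc (t / 2) (2 * t) ×ˢ Icc 0 1)
    (by
      have : ContinuousOn G (Icc (t / 2) (2 * t) ×ˢ Icc 0 1) :=
        hG.mono (prod_mono_left fun s hs => lt_of_lt_of_le (by positivity) hs.1)
      fun_prop)
  have hIoc : uIoc (0 : ℝ) 1 = Ioc 0 1 := uIoc_of_le zero_le_one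
  have main := intervalIntegral.hasDerivAt_integral_of_dominated_loc_of_deriv_le
    (μ := volume) (a := 0) (b := 1) (F := fun s x => phi (n + 1) x * v s x)
    (F' := fun s x => phi (n + 1) x * G (s, x)) (x₀ := t) (s := Ioo (t / 2) (2 * t))
    (bound := fun _ => C) (Ioo_mem_nhds (by linarith) (by linarith))
    (by
      filter_upwards [Ioi_mem_nhds ht] with s hs
      rw [hIoc]
      refine ContinuousOn.aestronglyMeasurable ?_ measurableSet_Ioc
      have := (hslice s hs).mono Ioc_subset_Icc_self
      fun_prop)
    (by
      refine ContinuousOn.intervalIntegrable ?_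
      rw [uIcc_of_le zero_le_one]
      have := hslice t ht
      fun_prop)
    (by
      rw [hIoc]
      refine ContinuousOn.aestronglyMeasurable ?_ measurableSet_Ioc
      exact (continuous_phi _).continuousOn.mul (hGslice.mono Ioc_subset_Icc_self))
    (by
      refine Filter.Eventually.of_forall fun x hx s hs => ?_
      rw [hIoc] at hx
      exact hC (s, x) ⟨Ioo_subset_Icc_self hs, Ioc_subset_Icc_self hx⟩)
    intervalIntegrable_const
    (by
      refine Filter.Eventually.of_forall fun x hx s hs => ?_
      rw [hIoc] at hx
      exact (hd s (by linarith [hs.1]) x (Ioc_subset_Icc_self hx)).const_mul _)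
  refine main.2.congr_deriv ?_
  refine intervalIntegral.integral_congr fun x hx => ?_
  rw [uIcc_of_le zero_le_one] at hx
  simp only [(hd t ht x hx).deriv]

/-- The coordinates of a solution of the heat equation satisfy scalar linear equations driven by
the boundary value. -/
lemma hasDerivAt_sineCoeff {p : ℝ} {v : ℝ → ℝ → ℝ}
    (h1 : ContDiffOn ℝ 1 (fun z : ℝ × ℝ => v z.1 z.2) (Ioi 0 ×ˢ Icc 0 1))
    (h2 : ∀ t : ℝ, 0 < t → ContDiffOn ℝ 2 (v t) (Icc 0 1))
    (heat : ∀ t : ℝ, 0 < t → ∀ x ∈ Ioo (0 : ℝ) 1,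
      deriv (fun s => v s x) t = p * deriv (deriv (v t)) x)
    (left : ∀ t : ℝ, 0 < t → v t 0 = 0) (n : ℕ) {t : ℝ} (ht : 0 < t) :
    HasDerivAt (fun s => ∫ x in (0 : ℝ)..1, phi (n + 1) x * v s x)
      (-(p * freq n ^ 2) * (∫ x in (0 : ℝ)..1, phi (n + 1) x * v t x)
        + p * (Real.sqrt 2 * freq n * (-1) ^ n) * v t 1) t := by
  refine (hasDerivAt_integral_phi_mul h1 n ht).congr_deriv ?_
  have e : ∫ x in (0 : ℝ)..1, phi (n + 1) x * deriv (fun s => v s x) t =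
      p * ∫ x in (0 : ℝ)..1, phi (n + 1) x * deriv (deriv (v t)) x := by
    rw [← intervalIntegral.integral_const_mul, ← integral_Ioo_eq, ← integral_Ioo_eq]
    refine setIntegral_congr_fun measurableSet_Ioo fun x hx => ?_
    simp only [heat t ht x hx]
    ring
  rw [e, integral_phi_mul_deriv_deriv (h2 t ht) (left t ht)]
  ring

/-! ### Linear differential equations in a normed space. -/

section LinearODE

variable {E : Type*} [NormedAddCommGroup E] [NormedSpace ℝ E]

lemma norm_le_exp_mul_of_hasDerivAt (A : E →L[ℝ] E) {y : ℝ → E} {a b : ℝ} (hab : a ≤ b)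
    (hy : ∀ t ∈ Icc a b, HasDerivAt y (A (y t)) t) :
    ‖y b‖ ≤ ‖y a‖ * Real.exp (‖A‖ * (b - a)) := by
  have h := norm_le_gronwallBound_of_norm_deriv_right_le (f := y) (f' := fun t => A (y t))
    (δ := ‖y a‖) (K := ‖A‖) (ε := 0) (a := a) (b := b)
    (fun t ht => (hy t ht).continuousAt.continuousWithinAt)
    (fun t ht => (hy t (Ico_subset_Icc_self ht)).hasDerivWithinAt) le_rfl
    (fun t _ => by simpa using A.le_opNorm (y t)) b (right_mem_Icc.2 hab)
  rwa [gronwallBound_ε0] at h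

/-- A solution of `y' = A y` on `(0,∞)` which tends to `0` at time `0` vanishes. -/
lemma eq_zero_of_hasDerivAt (A : E →L[ℝ] E) {y : ℝ → E} (hc : ContinuousAt y 0) (h0 : y 0 = 0)
    (hy : ∀ t : ℝ, 0 < t → HasDerivAt y (A (y t)) t) {t : ℝ} (ht : 0 < t) : y t = 0 := by
  -- The equation is available only for positive times, so Gronwall starts at `s > 0`, and then `s →
  -- 0`.
  have hlim : Filter.Tendsto (fun s => ‖y s‖ * Real.exp (‖A‖ * (t - s)))
      (nhdsWithin 0 (Ioi 0)) (nhds 0) := by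
    have h1 : ContinuousAt (fun s => ‖y s‖ * Real.exp (‖A‖ * (t - s))) 0 := by fun_prop
    have h2 := h1.tendsto
    simp only [h0, norm_zero, zero_mul] at h2
    exact h2.mono_left nhdsWithin_le_nhds
  rw [← norm_le_zero_iff]
  refine ge_of_tendsto hlim ?_
  filter_upwards [Ioo_mem_nhdsGT ht] with s hs
  exact norm_le_exp_mul_of_hasDerivAt A hs.2.le fun r hr => hy r (hs.1.trans_le hr.1)

variable [CompleteSpace E]

lemma hasDerivAt_exp_smul_apply (A : E →L[ℝ] E) (a : E) (t : ℝ) :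
    HasDerivAt (fun s : ℝ => NormedSpace.exp (s • A) a) (A (NormedSpace.exp (t • A) a)) t :=
  (hasDerivAt_exp_smul_const' A t).clm_apply (hasDerivAt_const t a) |>.congr_deriv (by simp)

lemma norm_exp_smul_apply_le (A : E →L[ℝ] E) (a : E) {t : ℝ} (ht : 0 ≤ t) :
    ‖NormedSpace.exp (t • A) a‖ ≤ ‖a‖ * Real.exp (‖A‖ * t) := by
  simpa using norm_le_exp_mul_of_hasDerivAt A ht fun s _ => hasDerivAt_exp_smul_apply A a s

end LinearODE

/-! ### Duhamel integrals. -/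

/-- The solution of `y' = f - l y`, `y 0 = 0`. -/
def duhamel (l : ℝ) (f : ℝ → ℝ) (t : ℝ) : ℝ :=
  Real.exp (-(l * t)) * ∫ s in (0 : ℝ)..t, Real.exp (l * s) * f s

@[simp] lemma duhamel_zero (l : ℝ) (f : ℝ → ℝ) : duhamel l f 0 = 0 := by simp [duhamel]

lemma hasDerivAt_duhamel (l : ℝ) {f : ℝ → ℝ} (hf : Continuous f) (t : ℝ) :
    HasDerivAt (duhamel l f) (f t - l * duhamel l f t) t := by
  have h1 : HasDerivAt (fun t => Real.exp (-(l * t))) (Real.exp (-(l * t)) * -(l * 1)) t :=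
    ((hasDerivAt_id t).const_mul l).neg.exp
  have hg : Continuous fun s => Real.exp (l * s) * f s := by fun_prop
  have h2 := hg.integral_hasStrictDerivAt 0 t |>.hasDerivAt
  refine (h1.mul h2).congr_deriv ?_
  have h3 : Real.exp (-(l * t)) * Real.exp (l * t) = 1 := by
    rw [← Real.exp_add, neg_add_cancel, Real.exp_zero]
  rw [duhamel]
  linear_combination f t * h3

/-- The kernel `exp(-l(t - s))` has mass at most `1/l`. With `l = rate p n`, of order `n²`, this is
a gain of two powers of `n`. -/
lemma abs_duhamel_le {l : ℝ} (hl : 0 < l) {f : ℝ → ℝ} {t M : ℝ}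
    (ht : 0 ≤ t) (hM : ∀ s ∈ Icc 0 t, |f s| ≤ M) : l * |duhamel l f t| ≤ M := by
  have hM0 : 0 ≤ M := (abs_nonneg _).trans (hM 0 ⟨le_rfl, ht⟩)
  have h1 : |∫ s in (0 : ℝ)..t, Real.exp (l * s) * f s| ≤
      ∫ s in (0 : ℝ)..t, Real.exp (l * s) * M := by
    rw [← Real.norm_eq_abs]
    refine intervalIntegral.norm_integral_le_of_norm_le ht ?_
      (Continuous.intervalIntegrable (by fun_prop) _ _)
    refine Filter.Eventually.of_forall fun s hs => ?_
    rw [norm_mul, Real.norm_eq_abs, Real.norm_eq_abs, Real.abs_exp]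
    gcongr
    exact hM s (Ioc_subset_Icc_self hs)
  have h2 : ∫ s in (0 : ℝ)..t, Real.exp (l * s) * M = l⁻¹ * (Real.exp (l * t) - 1) * M := by
    rw [intervalIntegral.integral_mul_const,
      intervalIntegral.integral_comp_mul_left (fun s => Real.exp s) hl.ne']
    simp
  have h3 : Real.exp (-(l * t)) * Real.exp (l * t) = 1 := by
    rw [← Real.exp_add, neg_add_cancel, Real.exp_zero]
  rw [duhamel, abs_mul, Real.abs_exp]
  calc l * (Real.exp (-(l * t)) * |∫ s in (0 : ℝ)..t, Real.exp (l * s) * f s|)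
      ≤ l * (Real.exp (-(l * t)) * (l⁻¹ * (Real.exp (l * t) - 1) * M)) := by
        rw [← h2]; gcongr
    _ = (l * l⁻¹) * (Real.exp (-(l * t)) * Real.exp (l * t) - Real.exp (-(l * t))) * M := by ring
    _ = (1 - Real.exp (-(l * t))) * M := by rw [mul_inv_cancel₀ hl.ne', h3, one_mul]
    _ ≤ 1 * M := by gcongr; linarith [Real.exp_pos (-(l * t))]
    _ = M := one_mul M

/-! ### Termwise differentiation of sine series. -/

lemma summable_const_div_sq (C : ℝ) : Summable fun n : ℕ => C / ((n : ℝ) + 1) ^ 2 := by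
  have h := (summable_nat_add_iff 1).2 (Real.summable_one_div_nat_pow.2 (one_lt_two))
  refine (h.mul_left C).congr fun n => ?_
  push_cast
  ring

lemma sqrt_two_le_two : Real.sqrt 2 ≤ 2 := by
  rw [Real.sqrt_le_left (by norm_num)]; norm_num

lemma abs_phi_le (n : ℕ) (x : ℝ) : |phi n x| ≤ 2 := by
  rw [phi, abs_mul, abs_of_nonneg (Real.sqrt_nonneg _)]
  nlinarith [sqrt_two_le_two, Real.abs_sin_le_one (n * Real.pi * x), Real.sqrt_nonneg 2,
    abs_nonneg (Real.sin (n * Real.pi * x))]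

lemma freq_le (n : ℕ) : freq n ≤ 4 * ((n : ℝ) + 1) := by
  have := Real.pi_le_four
  rw [freq]
  nlinarith [(Nat.cast_nonneg n : (0 : ℝ) ≤ n)]

lemma abs_phi_deriv_le (n : ℕ) (x : ℝ) :
    |Real.sqrt 2 * freq n * Real.cos (freq n * x)| ≤ 8 * ((n : ℝ) + 1) := by
  have hf := (freq_pos n).le
  rw [abs_mul, abs_mul, abs_of_nonneg (Real.sqrt_nonneg _), abs_of_nonneg hf]
  calc _ ≤ 2 * (4 * ((n : ℝ) + 1)) * 1 := by
        gcongr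
        · exact sqrt_two_le_two
        · exact freq_le n
        · exact Real.abs_cos_le_one _
    _ = _ := by ring

section SineSeries

variable {c : ℕ → ℝ} {K : ℝ}

lemma summable_mul_phi_of_le (hc : ∀ n : ℕ, |c n| ≤ K / ((n : ℝ) + 1) ^ 2) (x : ℝ) :
    Summable fun n => c n * phi (n + 1) x := by
  refine Summable.of_norm_bounded (summable_const_div_sq (K * 2)) fun n => ?_
  rw [Real.norm_eq_abs, abs_mul, mul_div_right_comm]
  exact mul_le_mul (hc n) (abs_phi_le _ _) (abs_nonneg _) ((abs_nonneg _).trans (hc n))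

/-- Two derivatives in `x` cost a factor `(n+1)²`; fourth-power decay leaves a summable majorant. -/
lemma div_pow_four_mul_le {a : ℝ} (n : ℕ) (h : |a| ≤ K / ((n : ℝ) + 1) ^ 4) :
    |a| * ((n : ℝ) + 1) ^ 2 ≤ K / ((n : ℝ) + 1) ^ 2 := by
  calc |a| * ((n : ℝ) + 1) ^ 2 ≤ K / ((n : ℝ) + 1) ^ 4 * ((n : ℝ) + 1) ^ 2 := by gcongr
    _ = _ := by field_simp

lemma abs_mul_phi_deriv_le {a : ℝ} (n : ℕ) (h : |a| ≤ K / ((n : ℝ) + 1) ^ 4) (x : ℝ) :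
    |a * (Real.sqrt 2 * freq n * Real.cos (freq n * x))| ≤ (8 * K) / ((n : ℝ) + 1) ^ 2 := by
  rw [abs_mul]
  calc |a| * |Real.sqrt 2 * freq n * Real.cos (freq n * x)|
      ≤ |a| * (8 * ((n : ℝ) + 1) ^ 2) := by
        gcongr
        refine (abs_phi_deriv_le n x).trans ?_
        nlinarith [(Nat.cast_nonneg n : (0 : ℝ) ≤ n)]
    _ = 8 * (|a| * ((n : ℝ) + 1) ^ 2) := by ring
    _ ≤ 8 * (K / ((n : ℝ) + 1) ^ 2) := by gcongr; exact div_pow_four_mul_le n h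
    _ = _ := by ring

lemma abs_freq_sq_mul_phi_le {a : ℝ} (n : ℕ) (h : |a| ≤ K / ((n : ℝ) + 1) ^ 4) (x : ℝ) :
    |a * -(freq n ^ 2 * phi (n + 1) x)| ≤ (32 * K) / ((n : ℝ) + 1) ^ 2 := by
  have hf := (freq_pos n).le
  rw [abs_mul, abs_neg, abs_mul, abs_of_nonneg (sq_nonneg (freq n))]
  calc |a| * (freq n ^ 2 * |phi (n + 1) x|)
      ≤ |a| * ((4 * ((n : ℝ) + 1)) ^ 2 * 2) := by
        gcongr
        · exact freq_le n
        · exact abs_phi_le _ _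
    _ = 32 * (|a| * ((n : ℝ) + 1) ^ 2) := by ring
    _ ≤ 32 * (K / ((n : ℝ) + 1) ^ 2) := by gcongr; exact div_pow_four_mul_le n h
    _ = _ := by ring

lemma le_div_sq_of_le_div_pow_four {a : ℝ} (n : ℕ) (h : |a| ≤ K / ((n : ℝ) + 1) ^ 4) :
    |a| ≤ K / ((n : ℝ) + 1) ^ 2 := by
  refine le_trans ?_ (div_pow_four_mul_le n h)
  have : (1 : ℝ) ≤ ((n : ℝ) + 1) ^ 2 := by nlinarith [(Nat.cast_nonneg n : (0 : ℝ) ≤ n)]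
  nlinarith [abs_nonneg a]

lemma hasDerivAt_tsum_mul_phi (hc : ∀ n : ℕ, |c n| ≤ K / ((n : ℝ) + 1) ^ 4) (x : ℝ) :
    HasDerivAt (fun x => ∑' n, c n * phi (n + 1) x)
      (∑' n, c n * (Real.sqrt 2 * freq n * Real.cos (freq n * x))) x :=
  hasDerivAt_tsum (summable_const_div_sq (8 * K))
    (fun n x => (hasDerivAt_phi n x).const_mul (c n))
    (fun n x => abs_mul_phi_deriv_le n (hc n) x)
    (summable_mul_phi_of_le (fun n => le_div_sq_of_le_div_pow_four n (hc n)) 0) x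

lemma hasDerivAt_tsum_mul_phi_deriv (hc : ∀ n : ℕ, |c n| ≤ K / ((n : ℝ) + 1) ^ 4) (x : ℝ) :
    HasDerivAt (fun x => ∑' n, c n * (Real.sqrt 2 * freq n * Real.cos (freq n * x)))
      (∑' n, c n * -(freq n ^ 2 * phi (n + 1) x)) x :=
  hasDerivAt_tsum (summable_const_div_sq (32 * K))
    (fun n x => (hasDerivAt_phi_deriv n x).const_mul (c n))
    (fun n x => abs_freq_sq_mul_phi_le n (hc n) x) (y₀ := 0)
    (Summable.of_norm_bounded (summable_const_div_sq (8 * K))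
      fun n => abs_mul_phi_deriv_le n (hc n) 0) x

lemma continuous_tsum_mul_phi_deriv_deriv (hc : ∀ n : ℕ, |c n| ≤ K / ((n : ℝ) + 1) ^ 4) :
    Continuous fun x => ∑' n, c n * -(freq n ^ 2 * phi (n + 1) x) :=
  continuous_tsum (fun n => by fun_prop) (summable_const_div_sq (32 * K))
    fun n x => abs_freq_sq_mul_phi_le n (hc n) x

end SineSeries

lemma contDiff_two_of_hasDerivAt {f f' f'' : ℝ → ℝ} (h1 : ∀ x, HasDerivAt f (f' x) x)
    (h2 : ∀ x, HasDerivAt f' (f'' x) x) (hc : Continuous f'') : ContDiff ℝ 2 f := by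
  have e1 : deriv f = f' := funext fun x => (h1 x).deriv
  have e2 : deriv f' = f'' := funext fun x => (h2 x).deriv
  rw [show (2 : WithTop ℕ∞) = 1 + 1 by norm_num, contDiff_succ_iff_deriv]
  refine ⟨fun x => (h1 x).differentiableAt, by simp, ?_⟩
  rw [e1, contDiff_one_iff_deriv, e2]
  exact ⟨fun x => (h2 x).differentiableAt, hc⟩

section TimeDependent

variable {v v' : ℕ → ℝ → ℝ}

/-- Local bounds, on compact subintervals of `(0,∞)`, under which `∑ vₙ(t) φₙ₊₁(x)` may be
differentiated once in time and twice in space term by term. -/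
def CoeffBound (v v' : ℕ → ℝ → ℝ) : Prop :=
  ∀ δ T : ℝ, 0 < δ → ∃ K : ℝ, ∀ n : ℕ, ∀ t ∈ Ioo δ T,
    |v n t| ≤ K / ((n : ℝ) + 1) ^ 4 ∧ |v' n t| ≤ K / ((n : ℝ) + 1) ^ 2

lemma CoeffBound.exists_bound (hb : CoeffBound v v') {t : ℝ} (ht : 0 < t) :
    ∃ K : ℝ, ∀ n : ℕ, |v n t| ≤ K / ((n : ℝ) + 1) ^ 4 ∧ |v' n t| ≤ K / ((n : ℝ) + 1) ^ 2 := by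
  obtain ⟨K, hK⟩ := hb (t / 2) (2 * t) (by positivity)
  exact ⟨K, fun n => hK n t ⟨by linarith, by linarith⟩⟩

lemma CoeffBound.hasDerivAt_tsum (hb : CoeffBound v v')
    (hv : ∀ n t, 0 < t → HasDerivAt (v n) (v' n t) t) {t : ℝ} (ht : 0 < t) (x : ℝ) :
    HasDerivAt (fun s => ∑' n, v n s * phi (n + 1) x) (∑' n, v' n t * phi (n + 1) x) t := by
  obtain ⟨K, hK⟩ := hb (t / 2) (2 * t) (by positivity)
  have htm : t ∈ Ioo (t / 2) (2 * t) := ⟨by linarith, by linarith⟩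
  refine hasDerivAt_tsum_of_isPreconnected (summable_const_div_sq (K * 2)) isOpen_Ioo
    isPreconnected_Ioo (t := Ioo (t / 2) (2 * t)) (y₀ := t)
    (fun n s hs => (hv n s (by linarith [hs.1])).mul_const _) (fun n s hs => ?_) htm
    (summable_mul_phi_of_le
      (fun n => le_div_sq_of_le_div_pow_four n (hK n t htm).1) x) htm
  rw [Real.norm_eq_abs, abs_mul, mul_div_right_comm]
  exact mul_le_mul (hK n s hs).2 (abs_phi_le _ _) (abs_nonneg _)
    ((abs_nonneg _).trans (hK n s hs).2)

lemma CoeffBound.contDiffOn (hb : CoeffBound v v')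
    (hv : ∀ n t, 0 < t → HasDerivAt (v n) (v' n t) t)
    (hv' : ∀ n, ContinuousOn (v' n) (Ioi 0)) :
    ContDiffOn ℝ 1 (fun z : ℝ × ℝ => ∑' n, v n z.1 * phi (n + 1) z.2) (Ioi 0 ×ˢ univ) := by
  rintro ⟨t, x⟩ ⟨ht, -⟩
  replace ht : 0 < t := ht
  refine ContDiffAt.contDiffWithinAt ?_
  obtain ⟨K, hK⟩ := hb (t / 2) (2 * t) (by positivity)
  have htm : t ∈ Ioo (t / 2) (2 * t) := ⟨by linarith, by linarith⟩
  set S : Set (ℝ × ℝ) := Ioo (t / 2) (2 * t) ×ˢ univ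
  have hS : IsOpen S := isOpen_Ioo.prod isOpen_univ
  have hpos : ∀ z ∈ S, 0 < z.1 := fun z hz => by
    have := hz.1.1
    linarith
  -- The Fréchet derivative of each term, majorized below by `8K` for the space part plus `2K` for
  -- the time part.
  set f' : ℕ → ℝ × ℝ → (ℝ × ℝ →L[ℝ] ℝ) := fun n z =>
    (v n z.1) • (Real.sqrt 2 * freq n * Real.cos (freq n * z.2)) • ContinuousLinearMap.snd ℝ ℝ ℝ
      + (phi (n + 1) z.2) • (v' n z.1) • ContinuousLinearMap.fst ℝ ℝ ℝ with hf'
  have hd : ∀ n, ∀ z ∈ S,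
      HasFDerivAt (fun z : ℝ × ℝ => v n z.1 * phi (n + 1) z.2) (f' n z) z := by
    intro n z hz
    have h1 : HasFDerivAt (fun z : ℝ × ℝ => v n z.1) (v' n z.1 • ContinuousLinearMap.fst ℝ ℝ ℝ) z :=
      (hv n z.1 (hpos z hz)).comp_hasFDerivAt z hasFDerivAt_fst
    have h2 : HasFDerivAt (fun z : ℝ × ℝ => phi (n + 1) z.2)
        ((Real.sqrt 2 * freq n * Real.cos (freq n * z.2)) • ContinuousLinearMap.snd ℝ ℝ ℝ) z :=
      (hasDerivAt_phi n z.2).comp_hasFDerivAt z hasFDerivAt_snd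
    exact h1.mul h2
  have hbd : ∀ n, ∀ z ∈ S, ‖f' n z‖ ≤ (10 * K) / ((n : ℝ) + 1) ^ 2 := by
    intro n z hz
    obtain ⟨hK1, hK2⟩ := hK n z.1 hz.1
    refine (norm_add_le _ _).trans ?_
    have e1 : ‖(v n z.1) • (Real.sqrt 2 * freq n * Real.cos (freq n * z.2)) •
        ContinuousLinearMap.snd ℝ ℝ ℝ‖ ≤ (8 * K) / ((n : ℝ) + 1) ^ 2 := by
      rw [smul_smul, norm_smul]
      refine (mul_le_of_le_one_right (norm_nonneg _)
        (ContinuousLinearMap.norm_snd_le ℝ ℝ ℝ)).trans ?_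
      exact abs_mul_phi_deriv_le n hK1 z.2
    have e2 : ‖(phi (n + 1) z.2) • (v' n z.1) • ContinuousLinearMap.fst ℝ ℝ ℝ‖ ≤
        2 * (K / ((n : ℝ) + 1) ^ 2) := by
      rw [smul_smul, norm_smul]
      refine (mul_le_of_le_one_right (norm_nonneg _)
        (ContinuousLinearMap.norm_fst_le ℝ ℝ ℝ)).trans ?_
      rw [norm_mul]
      exact mul_le_mul (abs_phi_le _ _) hK2 (abs_nonneg _) zero_le_two
    calc _ ≤ (8 * K) / ((n : ℝ) + 1) ^ 2 + 2 * (K / ((n : ℝ) + 1) ^ 2) := add_le_add e1 e2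
      _ = _ := by ring
  have hsum : Summable fun n => v n t * phi (n + 1) x :=
    summable_mul_phi_of_le (fun n => le_div_sq_of_le_div_pow_four n (hK n t htm).1) x
  have hmem : (t, x) ∈ S := ⟨htm, mem_univ _⟩
  rw [show (1 : WithTop ℕ∞) = ((1 : ℕ) : WithTop ℕ∞) by norm_num]
  have hfd : ∀ z ∈ S, HasFDerivAt (fun z : ℝ × ℝ => ∑' n, v n z.1 * phi (n + 1) z.2)
      (∑' n, f' n z) z := fun z hz =>
    hasFDerivAt_tsum_of_isPreconnected (summable_const_div_sq (10 * K)) hS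
      (isPreconnected_Ioo.prod isPreconnected_univ) hd hbd hmem hsum hz
  have hcont : ContinuousOn (fun z => ∑' n, f' n z) S := by
    refine continuousOn_tsum (fun n => ?_) (summable_const_div_sq (10 * K)) hbd
    have c1 : ContinuousOn (fun z : ℝ × ℝ => v n z.1) S := fun z hz =>
      ((hv n z.1 (hpos z hz)).continuousAt.comp continuousAt_fst).continuousWithinAt
    have c2 : ContinuousOn (fun z : ℝ × ℝ => v' n z.1) S :=
      (hv' n).comp continuousOn_fst fun z hz => hpos z hz
    have c3 : Continuous (fun z : ℝ × ℝ => phi (n + 1) z.2) := by fun_prop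
    have c4 : Continuous (fun z : ℝ × ℝ => Real.sqrt 2 * freq n * Real.cos (freq n * z.2)) := by
      fun_prop
    exact (c1.smul (c4.continuousOn.smul continuousOn_const)).add
      (c3.continuousOn.smul (c2.smul continuousOn_const))
  have hC : ContDiffOn ℝ ((1 : ℕ) : WithTop ℕ∞)
      (fun z : ℝ × ℝ => ∑' n, v n z.1 * phi (n + 1) z.2) S := by
    rw [show ((1 : ℕ) : WithTop ℕ∞) = 0 + 1 by norm_num, contDiffOn_succ_iff_fderiv_of_isOpen hS]
    refine ⟨fun z hz => (hfd z hz).differentiableAt.differentiableWithinAt, by simp, ?_⟩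
    rw [contDiffOn_zero]
    exact hcont.congr fun z hz => (hfd z hz).fderiv
  exact hC.contDiffAt (hS.mem_nhds hmem)

end TimeDependent

/-! ### Elements and curves of `L²(0,1)` given by sine coordinates. -/

/-- The element `∑ cₙ φₙ₊₁` of `L²(0,1)`. -/
def synthesis (c : ℕ → ℝ) : L2 := ∑' n, c n • sineL2 n

section Synthesis

variable {c d : ℕ → ℝ}

lemma summable_smul_sineL2 (hc : Summable fun n => c n ^ 2) :
    Summable fun n => c n • sineL2 n := by
  have hm : Memℓp c 2 := memℓp_gen (by simpa using hc)
  simpa using (sineBasis.hasSum_repr_symm ⟨c, hm⟩).summable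

lemma synthesis_sub (hc : Summable fun n => c n ^ 2) (hd : Summable fun n => d n ^ 2) :
    synthesis c - synthesis d = synthesis fun n => c n - d n := by
  rw [synthesis, synthesis, ← (summable_smul_sineL2 hc).tsum_sub (summable_smul_sineL2 hd)]
  simp_rw [synthesis, sub_smul]

lemma inner_synthesis (hc : Summable fun n => c n ^ 2) (n : ℕ) :
    inner ℝ (sineL2 n) (synthesis c) = c n := by
  have h := (summable_smul_sineL2 hc).hasSum.mapL (innerSL ℝ (sineL2 n))
  have h2 : ∀ m, innerSL ℝ (sineL2 n) (c m • sineL2 m) = if m = n then c n else 0 := by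
    intro m
    have h3 := orthonormal_iff_ite.1 orthonormal_sineL2 n m
    rw [innerSL_apply_apply, inner_smul_right, h3]
    by_cases hmn : m = n
    · simp [hmn]
    · simp [hmn, Ne.symm hmn]
  simp_rw [h2] at h
  exact h.unique (hasSum_ite_eq n (c n))

lemma norm_sq_eq_tsum_inner (f : L2) : ‖f‖ ^ 2 = ∑' n, inner ℝ (sineL2 n) f ^ 2 := by
  rw [← real_inner_self_eq_norm_sq, ← sineBasis.tsum_inner_mul_inner f f]
  refine tsum_congr fun n => ?_
  rw [sineBasis_apply, real_inner_comm, sq]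

lemma summable_inner_sq (f : L2) : Summable fun n => inner ℝ (sineL2 n) f ^ 2 := by
  refine (sineBasis.hasSum_inner_mul_inner f f).summable.congr fun n => ?_
  rw [sineBasis_apply, real_inner_comm, sq]

lemma norm_sq_synthesis (hc : Summable fun n => c n ^ 2) :
    ‖synthesis c‖ ^ 2 = ∑' n, c n ^ 2 := by
  simp_rw [norm_sq_eq_tsum_inner, inner_synthesis hc]

lemma synthesis_inner (f : L2) : (synthesis fun n => inner ℝ (sineL2 n) f) = f := by
  have h := (sineBasis.hasSum_repr f).tsum_eq
  simpa [synthesis, HilbertBasis.repr_apply_apply] using h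

lemma eq_of_inner_eq {f g : L2} (h : ∀ n, inner ℝ (sineL2 n) f = inner ℝ (sineL2 n) g) :
    f = g := by
  rw [← synthesis_inner f, ← synthesis_inner g]
  simp_rw [h]

lemma abs_inner_sineL2_le (n : ℕ) (f : L2) : |inner ℝ (sineL2 n) f| ≤ ‖f‖ := by
  have h := abs_real_inner_le_norm (sineL2 n) f
  rwa [orthonormal_sineL2.1 n, one_mul] at h

/-- Continuity of a curve given by its coordinates, by dominated convergence. -/
lemma continuousAt_synthesis {X : Type*} [TopologicalSpace X] {v : X → ℕ → ℝ} {s : X}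
    {β : ℕ → ℝ} (hβ : Summable fun n => β n ^ 2)
    (hb : ∀ᶠ t in nhds s, ∀ n, |v t n| ≤ β n) (hv : ∀ n, ContinuousAt (fun t => v t n) s) :
    ContinuousAt (fun t => synthesis (v t)) s := by
  have hsum : ∀ t, (∀ n, |v t n| ≤ β n) → Summable fun n => v t n ^ 2 := fun t ht =>
    hβ.of_nonneg_of_le (fun n => sq_nonneg _) fun n => sq_le_sq' (abs_le.1 (ht n)).1
      (abs_le.1 (ht n)).2
  have hs := hb.self_of_nhds
  have hlim : Filter.Tendsto (fun t => ∑' n, (v t n - v s n) ^ 2) (nhds s) (nhds 0) := by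
    rw [show (0 : ℝ) = ∑' _ : ℕ, (0 : ℝ) by simp]
    refine tendsto_tsum_of_dominated_convergence (hβ.mul_left 4) (fun n => ?_) ?_
    · have h1 : ContinuousAt (fun t => (v t n - v s n) ^ 2) s :=
        ((hv n).sub continuousAt_const).pow 2
      simpa using h1.tendsto
    · filter_upwards [hb] with t ht n
      rw [Real.norm_eq_abs, abs_of_nonneg (sq_nonneg _)]
      have h1 := abs_le.1 (ht n)
      have h2 := abs_le.1 (hs n)
      nlinarith
  have hlim2 : Filter.Tendsto (fun t => Real.sqrt (∑' n, (v t n - v s n) ^ 2)) (nhds s)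
      (nhds 0) := by
    simpa using hlim.sqrt
  rw [ContinuousAt, tendsto_iff_norm_sub_tendsto_zero]
  refine hlim2.congr' ?_
  filter_upwards [hb] with t ht
  rw [synthesis_sub (hsum t ht) (hsum s hs), ← norm_sq_synthesis, Real.sqrt_sq (norm_nonneg _)]
  -- Square summability of the difference, the side condition of `norm_sq_synthesis`, from `(a - b)²
  -- ≤ 2(a² + b²)`.
  refine ((hsum t ht).add (hsum s hs)).mul_left 2 |>.of_nonneg_of_le (fun n => sq_nonneg _)
    fun n => ?_
  nlinarith [sq_nonneg (v t n + v s n)]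

lemma coeFn_sum_smul_sineL2 (c : ℕ → ℝ) (s : Finset ℕ) :
    ((∑ n ∈ s, c n • sineL2 n : L2) : ℝ → ℝ) =ᵐ[volume.restrict (Ioo (0 : ℝ) 1)]
      fun x => ∑ n ∈ s, c n * phi (n + 1) x := by
  induction s using Finset.induction_on with
  | empty =>
    simp only [Finset.sum_empty]
    exact Lp.coeFn_zero ℝ 2 _
  | insert n s hn ih =>
    rw [Finset.sum_insert hn]
    filter_upwards [Lp.coeFn_add (c n • sineL2 n) (∑ n ∈ s, c n • sineL2 n),
      Lp.coeFn_smul (c n) (sineL2 n), ih,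
      coeFn_toL2 (phi (n + 1)) (continuous_phi _).continuousOn] with x h1 h2 h3 h4
    rw [h1, Pi.add_apply, h2, h3, Finset.sum_insert hn, Pi.smul_apply, smul_eq_mul,
      sineL2, h4]

/-- Convergence in `L²` gives a subsequence of partial sums converging almost everywhere, and its
limit must be the pointwise sum. -/
lemma coeFn_synthesis (hc : Summable fun n => c n ^ 2)
    (hp : ∀ x, Summable fun n => c n * phi (n + 1) x) :
    synthesis c =ᵐ[volume.restrict (Ioo (0 : ℝ) 1)] fun x => ∑' n, c n * phi (n + 1) x := by
  have h1 := (summable_smul_sineL2 hc).hasSum.tendsto_sum_nat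
  obtain ⟨ns, hns, hlim⟩ := (tendstoInMeasure_of_tendsto_Lp h1).exists_seq_tendsto_ae
  have h2 : ∀ᵐ x ∂(volume.restrict (Ioo (0 : ℝ) 1)), ∀ m : ℕ,
      ((∑ n ∈ Finset.range m, c n • sineL2 n : L2) : ℝ → ℝ) x =
        ∑ n ∈ Finset.range m, c n * phi (n + 1) x :=
    ae_all_iff.2 fun m => coeFn_sum_smul_sineL2 c _
  filter_upwards [hlim, h2] with x hx hx2
  simp_rw [hx2] at hx
  exact tendsto_nhds_unique hx ((hp x).hasSum.tendsto_sum_nat.comp hns.tendsto_atTop)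

end Synthesis

/-! ### Coordinates of heat curves and uniqueness. -/

/-- A function solving the heat equation with `u(t,0) = 0`, together with its curve of profiles in
`L²(0,1)`; nothing is prescribed at `x = 1` and at `t = 0`. -/
structure IsHeatCurve (p : ℝ) (u : ℝ → ℝ → ℝ) (U : C(ℝ≥0, L2)) : Prop where
  profile : ∀ t : ℝ≥0, U t =ᵐ[volume.restrict (Ioo (0 : ℝ) 1)] u t
  contDiffOn_one : ContDiffOn ℝ 1 (fun z : ℝ × ℝ => u z.1 z.2) (Ioi 0 ×ˢ Icc 0 1)
  contDiffOn_two : ∀ t : ℝ, 0 < t → ContDiffOn ℝ 2 (u t) (Icc 0 1)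
  heat : ∀ t : ℝ, 0 < t → ∀ x ∈ Ioo (0 : ℝ) 1,
    deriv (fun s => u s x) t = p * deriv (deriv (u t)) x
  left_bc : ∀ t : ℝ, 0 < t → u t 0 = 0

lemma IsSolution.isHeatCurve {p : ℝ} {k : ℝ → ℝ} {u₀ : L2} {u : ℝ → ℝ → ℝ} {U : C(ℝ≥0, L2)}
    (h : IsSolution p k u₀ u U) : IsHeatCurve p u U :=
  ⟨h.profile, h.contDiffOn_one, h.contDiffOn_two, h.heat, h.left_bc⟩

/-- The decay rate of the mode `phi (n + 1)`. -/
def rate (p : ℝ) (n : ℕ) : ℝ := p * freq n ^ 2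

/-- The gain from the boundary value at `x = 1` to the mode `phi (n + 1)`. -/
def gain (p : ℝ) (n : ℕ) : ℝ := p * (Real.sqrt 2 * freq n * (-1) ^ n)

/-- The coordinate of `U t` along `phi (n + 1)`, as a function on the real line. -/
def coord (U : C(ℝ≥0, L2)) (n : ℕ) (t : ℝ) : ℝ := inner ℝ (sineL2 n) (U t.toNNReal)

/-- `Real.toNNReal` freezes the curve at its initial value for negative times, so continuity at `0`
is two-sided, as `eq_zero_of_hasDerivAt` requires. -/
lemma continuous_coord (U : C(ℝ≥0, L2)) (n : ℕ) : Continuous (coord U n) := by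
  unfold coord
  exact continuous_const.inner (U.continuous.comp continuous_real_toNNReal)

lemma coord_zero (U : C(ℝ≥0, L2)) (n : ℕ) : coord U n 0 = inner ℝ (sineL2 n) (U 0) := by
  simp [coord]

section HeatCurve

variable {p : ℝ} {u v : ℝ → ℝ → ℝ} {U V : C(ℝ≥0, L2)}

lemma IsHeatCurve.coord_eq (h : IsHeatCurve p u U) (n : ℕ) {t : ℝ} (ht : 0 ≤ t) :
    coord U n t = ∫ x in (0 : ℝ)..1, phi (n + 1) x * u t x := by
  rw [coord, inner_sineL2, ← integral_Ioo_eq, ← integral_Ioo_eq]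
  refine integral_congr_ae ?_
  have := h.profile t.toNNReal
  rw [Real.coe_toNNReal t ht] at this
  filter_upwards [this] with x hx
  rw [hx]

lemma IsHeatCurve.hasDerivAt_coord (h : IsHeatCurve p u U) (n : ℕ) {t : ℝ} (ht : 0 < t) :
    HasDerivAt (coord U n) (-rate p n * coord U n t + gain p n * u t 1) t := by
  have h1 := hasDerivAt_sineCoeff h.contDiffOn_one h.contDiffOn_two h.heat h.left_bc n ht
  rw [← h.coord_eq n ht.le] at h1
  refine h1.congr_of_eventuallyEq ?_
  filter_upwards [Ioi_mem_nhds ht] with s hs using h.coord_eq n (le_of_lt hs)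

lemma IsHeatCurve.continuousOn (h : IsHeatCurve p u U) {t : ℝ} (ht : 0 < t) :
    ContinuousOn (u t) (Icc 0 1) := (h.contDiffOn_two t ht).continuousOn

lemma IsHeatCurve.integral_kernel_mul (h : IsHeatCurve p u U) {N : ℕ} (κ : Fin N → ℝ) {t : ℝ}
    (ht : 0 < t) :
    ∫ s in (0 : ℝ)..1, kernel κ s * u t s = ∑ i : Fin N, κ i * coord U i t := by
  simp_rw [kernel, Finset.sum_mul, mul_assoc]
  rw [intervalIntegral.integral_finsetSum]
  · simp_rw [intervalIntegral.integral_const_mul, h.coord_eq _ ht.le]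
  · intro i _
    refine ContinuousOn.intervalIntegrable ?_
    rw [uIcc_of_le zero_le_one]
    have := h.continuousOn ht
    fun_prop

lemma eq_zero_of_hasDerivAt_mul {l : ℝ} {y : ℝ → ℝ} (hc : ContinuousAt y 0) (h0 : y 0 = 0)
    (hy : ∀ t : ℝ, 0 < t → HasDerivAt y (l * y t) t) {t : ℝ} (ht : 0 < t) : y t = 0 :=
  eq_zero_of_hasDerivAt (l • ContinuousLinearMap.id ℝ ℝ) hc h0 (fun t ht => by simpa using hy t ht)
    ht

/-- A heat curve is determined by its initial value and by its values at `x = 1`. -/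
lemma IsHeatCurve.unique (hv : IsHeatCurve p v V) (hu : IsHeatCurve p u U) (h0 : V 0 = U 0)
    (h1 : ∀ t : ℝ, 0 < t → v t 1 = u t 1) :
    V = U ∧ ∀ t : ℝ, 0 < t → ∀ x ∈ Icc (0 : ℝ) 1, v t x = u t x := by
  have hcoord : ∀ n, ∀ t : ℝ, 0 < t → coord V n t = coord U n t := by
    intro n t ht
    refine sub_eq_zero.1 (eq_zero_of_hasDerivAt_mul (l := -rate p n)
      (y := fun t => coord V n t - coord U n t)
      ((continuous_coord V n).sub (continuous_coord U n)).continuousAt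
      (by simp [coord_zero, h0]) (fun s hs => ?_) ht)
    refine ((hv.hasDerivAt_coord n hs).sub (hu.hasDerivAt_coord n hs)).congr_deriv ?_
    rw [h1 s hs]
    ring
  have hVU : ∀ t : ℝ≥0, V t = U t := by
    intro t
    rcases eq_or_lt_of_le (zero_le (a := t)) with rfl | ht
    · exact h0
    · exact eq_of_inner_eq fun n => by simpa [coord] using hcoord n t ht
  refine ⟨ContinuousMap.ext hVU, fun t ht => ?_⟩
  -- Equality in `L²` only gives equality almost everywhere; continuity on `[0,1]` upgrades it to
  -- every point, endpoints included.
  have hae : v t =ᵐ[volume.restrict (Icc (0 : ℝ) 1)] u t := by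
    rw [← Measure.restrict_congr_set Ioo_ae_eq_Icc]
    have e1 := hv.profile t.toNNReal
    have e2 := hu.profile t.toNNReal
    rw [Real.coe_toNNReal t ht.le] at e1 e2
    rw [hVU] at e1
    exact e1.symm.trans e2
  exact Measure.eqOn_Icc_of_ae_eq volume zero_ne_one hae (hv.continuousOn ht) (hu.continuousOn ht)

end HeatCurve

section Feedback

/-- The matrix of the linear system satisfied by the first `N` coordinates under the feedback
law. -/
def modalOp (p : ℝ) {N : ℕ} (κ : Fin N → ℝ) : (Fin N → ℝ) →L[ℝ] (Fin N → ℝ) :=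
  ContinuousLinearMap.pi fun i =>
    (-rate p i) • ContinuousLinearMap.proj i + gain p i • ∑ j, κ j • ContinuousLinearMap.proj j

lemma modalOp_apply (p : ℝ) {N : ℕ} (κ y : Fin N → ℝ) (i : Fin N) :
    modalOp p κ y i = -rate p i * y i + gain p i * ∑ j, κ j * y j := by
  simp [modalOp]

lemma IsSolution.unique {p : ℝ} {N : ℕ} {κ : Fin N → ℝ} {u₀ : L2} {u v : ℝ → ℝ → ℝ}
    {U V : C(ℝ≥0, L2)} (hv : IsSolution p (kernel κ) u₀ v V)
    (hu : IsSolution p (kernel κ) u₀ u U) :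
    V = U ∧ ∀ t : ℝ, 0 < t → ∀ x ∈ Icc (0 : ℝ) 1, v t x = u t x := by
  have h0 : V 0 = U 0 := hv.initial.trans hu.initial.symm
  have bv : ∀ t : ℝ, 0 < t → v t 1 = ∑ i : Fin N, κ i * coord V i t := fun t ht =>
    (hv.right_bc t ht).trans (hv.isHeatCurve.integral_kernel_mul κ ht)
  have bu : ∀ t : ℝ, 0 < t → u t 1 = ∑ i : Fin N, κ i * coord U i t := fun t ht =>
    (hu.right_bc t ht).trans (hu.isHeatCurve.integral_kernel_mul κ ht)
  refine hv.isHeatCurve.unique hu.isHeatCurve h0 fun t ht => ?_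
  -- The differences of the first `N` coordinates form a closed system with zero initial value; this
  -- makes the boundary values equal.
  have hz := eq_zero_of_hasDerivAt (modalOp p κ)
    (y := fun t (i : Fin N) => coord V i t - coord U i t)
    (Continuous.continuousAt (continuous_pi fun i =>
      (continuous_coord V i).sub (continuous_coord U i)))
    (by ext i; simp [coord_zero, h0])
    (fun s hs => hasDerivAt_pi.2 fun i => by
      refine ((hv.isHeatCurve.hasDerivAt_coord i hs).sub
        (hu.isHeatCurve.hasDerivAt_coord i hs)).congr_deriv ?_
      rw [modalOp_apply, bv s hs, bu s hs]
      simp_rw [mul_sub, Finset.sum_sub_distrib]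
      ring) ht
  rw [bv t ht, bu t ht]
  refine Finset.sum_congr rfl fun i _ => ?_
  rw [sub_eq_zero.1 (congrFun hz i)]

end Feedback

/-! ### Sine series of the cubic `(x³ - x)/(6p)`. -/

lemma eval_bernoulli_three (y : ℝ) :
    ((Polynomial.bernoulli 3).map (algebraMap ℚ ℝ)).eval y = y ^ 3 - 3 / 2 * y ^ 2 + y / 2 := by
  simp_rw [Polynomial.bernoulli, Finset.sum_range_succ, Polynomial.map_add,
    Polynomial.map_monomial]
  rw [Finset.sum_range_zero, Polynomial.map_zero, zero_add, bernoulli_one]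
  rw [bernoulli_eq_bernoulli'_of_ne_one zero_ne_one, bernoulli'_zero,
    bernoulli_eq_bernoulli'_of_ne_one (by decide : 2 ≠ 1), bernoulli'_two,
    bernoulli_eq_bernoulli'_of_ne_one (by decide : 3 ≠ 1), bernoulli'_three]
  simp [Nat.choose]
  ring

/-- The constant in the bound on the sine coefficients of `(x³ - x) / (6p)`. -/
def cubicBound (p : ℝ) : ℝ := Real.sqrt 2 / (p * Real.pi ^ 3)

/-- The sine coefficients of `(x³ - x) / (6p)`. -/
def cubicCoeff (p : ℝ) (n : ℕ) : ℝ := -((-1) ^ n * cubicBound p) / ((n : ℝ) + 1) ^ 3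

/-- This is the Fourier series of the Bernoulli polynomial `B₃` at `(1 + x)/2`, where `B₃((1 + x)/2)
= (x³ - x)/8`. The half-period shift produces the signs `(-1)ⁿ`, and the factor `2/(pπ³)` normalizes
to `1/(6p)`. -/
lemma hasSum_cubicCoeff {p : ℝ} (hp : 0 < p) {x : ℝ} (hx : x ∈ Icc (0 : ℝ) 1) :
    HasSum (fun n => cubicCoeff p n * phi (n + 1) x) ((x ^ 3 - x) / (6 * p)) := by
  have hpi := Real.pi_pos
  have h := hasSum_one_div_nat_pow_mul_sin one_ne_zero (x := (1 + x) / 2)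
    ⟨by linarith [hx.1], by linarith [hx.2]⟩
  rw [← hasSum_nat_add_iff' 1] at h
  rw [show 2 * 1 + 1 = 3 by norm_num, eval_bernoulli_three] at h
  have h2 := h.mul_left (2 / (p * Real.pi ^ 3))
  have hs2 := Real.mul_self_sqrt (zero_le_two (α := ℝ))
  have e1 : ∀ n : ℕ, 2 / (p * Real.pi ^ 3) * (1 / ((n + 1 : ℕ) : ℝ) ^ 3 *
      Real.sin (2 * Real.pi * ((n + 1 : ℕ) : ℝ) * ((1 + x) / 2))) =
      cubicCoeff p n * phi (n + 1) x := by
    intro n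
    have e : 2 * Real.pi * ((n + 1 : ℕ) : ℝ) * ((1 + x) / 2) =
        freq n * x + ((n + 1 : ℕ) : ℝ) * Real.pi := by
      rw [freq]; push_cast; ring
    rw [e, Real.sin_add_nat_mul_pi, phi_eq, cubicCoeff, cubicBound]
    push_cast
    rw [pow_succ]
    linear_combination ((-1) ^ n * Real.sin (freq n * x) / (p * Real.pi ^ 3) /
      ((n : ℝ) + 1) ^ 3) * hs2
  simp_rw [e1] at h2
  have e2 : 2 / (p * Real.pi ^ 3) * ((-1) ^ (1 + 1) * (2 * Real.pi) ^ 3 / 2 /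
      (Nat.factorial 3 : ℝ) *
        (((1 + x) / 2) ^ 3 - 3 / 2 * ((1 + x) / 2) ^ 2 + (1 + x) / 2 / 2) -
        ∑ i ∈ Finset.range 1, 1 / (i : ℝ) ^ 3 * Real.sin (2 * Real.pi * i * ((1 + x) / 2))) =
      (x ^ 3 - x) / (6 * p) := by
    rw [show Nat.factorial 3 = 6 from rfl]
    simp only [Finset.range_one, Finset.sum_singleton, Nat.cast_zero, mul_zero, zero_mul,
      Real.sin_zero, sub_zero]
    field_simp
    push_cast
    ring
  rwa [e2] at h2

lemma cubicBound_pos {p : ℝ} (hp : 0 < p) : 0 < cubicBound p := by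
  unfold cubicBound; positivity

/-- The true decay is cubic; the square is enough, since Duhamel's formula brings it to the fourth
power. -/
lemma abs_cubicCoeff_le {p : ℝ} (hp : 0 < p) (n : ℕ) :
    |cubicCoeff p n| ≤ cubicBound p / ((n : ℝ) + 1) ^ 2 := by
  have h1 : (1 : ℝ) ≤ (n : ℝ) + 1 := by linarith [(Nat.cast_nonneg n : (0 : ℝ) ≤ n)]
  have h2 := (cubicBound_pos hp).le
  rw [cubicCoeff, abs_div, abs_neg, abs_mul, abs_pow, abs_neg, abs_one, one_pow, one_mul,
    abs_of_nonneg h2, abs_of_nonneg (by positivity : (0 : ℝ) ≤ ((n : ℝ) + 1) ^ 3)]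
  gcongr
  norm_num

lemma rate_eq (p : ℝ) (n : ℕ) : rate p n = p * Real.pi ^ 2 * ((n : ℝ) + 1) ^ 2 := by
  rw [rate, freq]; ring

lemma rate_pos {p : ℝ} (hp : 0 < p) (n : ℕ) : 0 < rate p n := by
  have := freq_pos n
  unfold rate
  positivity

lemma abs_cubicCoeff_mul_duhamel_le {p : ℝ} (hp : 0 < p) {f : ℝ → ℝ} {t M : ℝ}
    (ht : 0 ≤ t) (hM : ∀ s ∈ Icc 0 t, |f s| ≤ M) (n : ℕ) :
    |cubicCoeff p n * duhamel (rate p n) f t| ≤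
      (cubicBound p / (p * Real.pi ^ 2) * M) / ((n : ℝ) + 1) ^ 4 := by
  have hl := rate_pos hp n
  have h := abs_duhamel_le hl ht hM
  have hD : |duhamel (rate p n) f t| ≤ M / rate p n := by
    rw [le_div_iff₀ hl]; linarith
  rw [abs_mul]
  calc |cubicCoeff p n| * |duhamel (rate p n) f t|
      ≤ cubicBound p / ((n : ℝ) + 1) ^ 2 * (M / rate p n) :=
        mul_le_mul (abs_cubicCoeff_le hp n) hD (abs_nonneg _)
          (div_nonneg (cubicBound_pos hp).le (by positivity))
    _ = _ := by
        rw [rate_eq]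
        field_simp

/-! ### Modes of the Dirichlet problem with source. -/

/-- The coordinate along `phi (n + 1)` of the solution of `y_t = p y_xx - f(t) (x³ - x) / (6p)`
with Dirichlet boundary conditions and initial value `g`. -/
def modeCoeff (p : ℝ) (g : L2) (f : ℝ → ℝ) (n : ℕ) (t : ℝ) : ℝ :=
  Real.exp (-(rate p n * t)) * inner ℝ (sineL2 n) g - cubicCoeff p n * duhamel (rate p n) f t

/-- The time derivative of `modeCoeff`. -/
def modeCoeffDeriv (p : ℝ) (g : L2) (f : ℝ → ℝ) (n : ℕ) (t : ℝ) : ℝ :=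
  -rate p n * modeCoeff p g f n t - cubicCoeff p n * f t

section ModeCoeff

variable {p : ℝ} {g : L2} {f : ℝ → ℝ}

@[simp] lemma modeCoeff_zero (n : ℕ) : modeCoeff p g f n 0 = inner ℝ (sineL2 n) g := by
  simp [modeCoeff]

lemma hasDerivAt_modeCoeff (hf : Continuous f) (n : ℕ) (t : ℝ) :
    HasDerivAt (modeCoeff p g f n) (modeCoeffDeriv p g f n t) t := by
  have h1 : HasDerivAt (fun t => Real.exp (-(rate p n * t)))
      (Real.exp (-(rate p n * t)) * -(rate p n * 1)) t :=
    ((hasDerivAt_id t).const_mul _).neg.exp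
  refine ((h1.mul_const _).sub ((hasDerivAt_duhamel (rate p n) hf t).const_mul _)).congr_deriv ?_
  rw [modeCoeffDeriv, modeCoeff]
  ring

lemma continuous_modeCoeff (hf : Continuous f) (n : ℕ) : Continuous (modeCoeff p g f n) :=
  continuous_iff_continuousAt.2 fun t => (hasDerivAt_modeCoeff hf n t).continuousAt

lemma continuous_modeCoeffDeriv (hf : Continuous f) (n : ℕ) :
    Continuous (modeCoeffDeriv p g f n) :=
  ((continuous_modeCoeff hf n).const_mul _).sub (hf.const_mul _)

/-- Unlike `coeffBound_modeCoeff`, this bound holds down to `t = 0`, and it is square summable: it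
serves the `L²` continuity and the norm estimate. -/
lemma abs_modeCoeff_le (hp : 0 < p) {t M : ℝ} (ht : 0 ≤ t) (hM : ∀ s ∈ Icc 0 t, |f s| ≤ M)
    (n : ℕ) :
    |modeCoeff p g f n t| ≤ |inner ℝ (sineL2 n) g| +
      (cubicBound p / (p * Real.pi ^ 2) * M) / ((n : ℝ) + 1) ^ 2 := by
  have hl := rate_pos hp n
  refine (abs_sub _ _).trans (add_le_add ?_ (le_div_sq_of_le_div_pow_four n
    (abs_cubicCoeff_mul_duhamel_le hp ht hM n)))
  rw [abs_mul, Real.abs_exp]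
  refine mul_le_of_le_one_left (abs_nonneg _) (Real.exp_le_one_iff.2 ?_)
  have : 0 ≤ rate p n * t := by positivity
  linarith

/-- Parabolic smoothing: `exp x ≥ x²/2` at `x = rate p n * δ`, which is of order `n²`. -/
lemma exp_neg_rate_mul_le (hp : 0 < p) {δ t : ℝ} (hδ : 0 < δ) (ht : δ ≤ t) (n : ℕ) :
    Real.exp (-(rate p n * t)) ≤ 2 / (p * Real.pi ^ 2 * δ) ^ 2 / ((n : ℝ) + 1) ^ 4 := by
  have hl := rate_pos hp n
  have h1 : (rate p n * δ) ^ 2 / 2 ≤ Real.exp (rate p n * δ) := by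
    have := Real.quadratic_le_exp_of_nonneg (x := rate p n * δ) (by positivity)
    nlinarith [mul_pos hl hδ]
  have h2 : Real.exp (-(rate p n * t)) ≤ Real.exp (-(rate p n * δ)) := by
    gcongr
  refine h2.trans ?_
  rw [Real.exp_neg]
  have h3 : 2 / (p * Real.pi ^ 2 * δ) ^ 2 / ((n : ℝ) + 1) ^ 4 =
      ((rate p n * δ) ^ 2 / 2)⁻¹ := by
    rw [rate_eq]
    field_simp
  rw [h3]
  gcongr

lemma coeffBound_modeCoeff (hp : 0 < p) (hf : Continuous f) :
    CoeffBound (modeCoeff p g f) (modeCoeffDeriv p g f) := by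
  intro δ T hδ
  obtain ⟨M, hM⟩ := isCompact_Icc.exists_bound_of_continuousOn (s := Icc 0 T) hf.continuousOn
  set K₁ := 2 / (p * Real.pi ^ 2 * δ) ^ 2 * ‖g‖ + cubicBound p / (p * Real.pi ^ 2) * M with hK₁
  set K₂ := p * Real.pi ^ 2 * K₁ + cubicBound p * M with hK₂
  have key : ∀ n : ℕ, ∀ t ∈ Ioo δ T, |modeCoeff p g f n t| ≤ K₁ / ((n : ℝ) + 1) ^ 4 ∧
      |modeCoeffDeriv p g f n t| ≤ K₂ / ((n : ℝ) + 1) ^ 2 := by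
    intro n t ht
    have ht0 : 0 ≤ t := (hδ.trans ht.1).le
    have hM' : ∀ s ∈ Icc 0 t, |f s| ≤ M := fun s hs => hM s ⟨hs.1, hs.2.trans ht.2.le⟩
    have h1 : |modeCoeff p g f n t| ≤ K₁ / ((n : ℝ) + 1) ^ 4 := by
      refine (abs_sub _ _).trans ?_
      rw [hK₁, add_div]
      refine add_le_add ?_ (abs_cubicCoeff_mul_duhamel_le hp ht0 hM' n)
      rw [abs_mul, Real.abs_exp, mul_div_right_comm]
      exact mul_le_mul (exp_neg_rate_mul_le hp hδ ht.1.le n) (abs_inner_sineL2_le n g)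
        (abs_nonneg _) (by positivity)
    refine ⟨h1, ?_⟩
    refine (abs_sub _ _).trans ?_
    rw [hK₂, add_div, abs_mul, abs_mul, abs_neg, abs_of_pos (rate_pos hp n)]
    refine add_le_add ?_ ?_
    · rw [rate_eq]
      calc p * Real.pi ^ 2 * ((n : ℝ) + 1) ^ 2 * |modeCoeff p g f n t|
          = p * Real.pi ^ 2 * (|modeCoeff p g f n t| * ((n : ℝ) + 1) ^ 2) := by ring
        _ ≤ p * Real.pi ^ 2 * (K₁ / ((n : ℝ) + 1) ^ 2) := by
            gcongr
            exact div_pow_four_mul_le n h1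
        _ = _ := by ring
    · rw [mul_div_right_comm]
      exact mul_le_mul (abs_cubicCoeff_le hp n) (hM' t ⟨ht0, le_rfl⟩) (abs_nonneg _)
        (div_nonneg (cubicBound_pos hp).le (by positivity))
  refine ⟨max K₁ K₂, fun n t ht => ⟨(key n t ht).1.trans ?_, (key n t ht).2.trans ?_⟩⟩
  · gcongr
    exact le_max_left _ _
  · gcongr
    exact le_max_right _ _

lemma sq_abs_add_div_sq_le (a L : ℝ) (n : ℕ) :
    (|a| + L / ((n : ℝ) + 1) ^ 2) ^ 2 ≤ 2 * a ^ 2 + 2 * L ^ 2 * (1 / ((n : ℝ) + 1) ^ 2) := by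
  have h1 : (1 / ((n : ℝ) + 1) ^ 2) ^ 2 ≤ 1 / ((n : ℝ) + 1) ^ 2 := by
    refine pow_le_of_le_one (by positivity) ?_ two_ne_zero
    rw [div_le_one (by positivity)]
    nlinarith [(Nat.cast_nonneg n : (0 : ℝ) ≤ n)]
  have h2 := sq_abs (a)
  have h3 : (L / ((n : ℝ) + 1) ^ 2) ^ 2 = L ^ 2 * (1 / ((n : ℝ) + 1) ^ 2) ^ 2 := by ring
  nlinarith [sq_nonneg (|a| - L / ((n : ℝ) + 1) ^ 2), sq_nonneg L]

lemma summable_sq_add_div_sq (g : L2) (L : ℝ) :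
    Summable fun n : ℕ => (|inner ℝ (sineL2 n) g| + L / ((n : ℝ) + 1) ^ 2) ^ 2 := by
  refine (((summable_inner_sq g).mul_left 2).add
    ((summable_const_div_sq 1).mul_left (2 * L ^ 2))).of_nonneg_of_le
    (fun n => sq_nonneg _) fun n => sq_abs_add_div_sq_le _ L n

lemma summable_modeCoeff_sq (hp : 0 < p) (hf : Continuous f) {t : ℝ} (ht : 0 ≤ t) :
    Summable fun n => modeCoeff p g f n t ^ 2 := by
  obtain ⟨M, hM⟩ := isCompact_Icc.exists_bound_of_continuousOn (s := Icc 0 t) hf.continuousOn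
  refine (summable_sq_add_div_sq g (cubicBound p / (p * Real.pi ^ 2) * M)).of_nonneg_of_le
    (fun n => sq_nonneg _) fun n => ?_
  have h := abs_le.1 (abs_modeCoeff_le (g := g) hp ht hM n)
  exact sq_le_sq' h.1 h.2

lemma continuous_synthesis_modeCoeff (hp : 0 < p) (hf : Continuous f) :
    Continuous fun t : ℝ≥0 => synthesis fun n => modeCoeff p g f n t := by
  refine continuous_iff_continuousAt.2 fun s => ?_
  obtain ⟨M, hM⟩ := isCompact_Icc.exists_bound_of_continuousOn (s := Icc 0 ((s : ℝ) + 1))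
    hf.continuousOn
  refine continuousAt_synthesis (v := fun (t : ℝ≥0) n => modeCoeff p g f n t)
    (summable_sq_add_div_sq g (cubicBound p / (p * Real.pi ^ 2) * M)) ?_ fun n => ?_
  · have h1 : ∀ᶠ t : ℝ≥0 in nhds s, (t : ℝ) < s + 1 :=
      (NNReal.continuous_coe.tendsto s).eventually_lt_const (by linarith)
    filter_upwards [h1] with t ht n
    exact abs_modeCoeff_le hp t.2 (fun r hr => hM r ⟨hr.1, hr.2.trans ht.le⟩) n
  · exact ((continuous_modeCoeff hf n).comp NNReal.continuous_coe).continuousAt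

/-- The sum of the series `∑ (n + 1)⁻²`. -/
def sumInvSq : ℝ := ∑' n : ℕ, 1 / ((n : ℝ) + 1) ^ 2

lemma norm_synthesis_modeCoeff_le (hp : 0 < p) (hf : Continuous f) {t M : ℝ} (ht : 0 ≤ t)
    (hM : ∀ s ∈ Icc 0 t, |f s| ≤ M) :
    ‖synthesis fun n => modeCoeff p g f n t‖ ≤
      2 * ‖g‖ + 2 * (1 + sumInvSq) * (cubicBound p / (p * Real.pi ^ 2) * M) := by
  set L := cubicBound p / (p * Real.pi ^ 2) * M with hL
  have hM0 : 0 ≤ M := (abs_nonneg _).trans (hM 0 ⟨le_rfl, ht⟩)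
  have hS : 0 ≤ sumInvSq := tsum_nonneg fun n => by positivity
  have hL0 : 0 ≤ L := by have := cubicBound_pos hp; positivity
  have hsum := summable_modeCoeff_sq (g := g) hp hf ht
  have h1 : ‖synthesis fun n => modeCoeff p g f n t‖ ^ 2 ≤
      2 * ‖g‖ ^ 2 + 2 * L ^ 2 * sumInvSq := by
    rw [norm_sq_synthesis hsum, norm_sq_eq_tsum_inner g, sumInvSq, ← tsum_mul_left,
      ← tsum_mul_left, ← ((summable_inner_sq g).mul_left 2).tsum_add
        ((summable_const_div_sq 1).mul_left (2 * L ^ 2))]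
    refine hsum.tsum_le_tsum (fun n => ?_) (((summable_inner_sq g).mul_left 2).add
        ((summable_const_div_sq 1).mul_left (2 * L ^ 2)))
    have h2 := abs_le.1 (abs_modeCoeff_le (g := g) hp ht hM n)
    refine (sq_le_sq' h2.1 h2.2).trans ?_
    exact sq_abs_add_div_sq_le _ L n
  -- The square of the claimed bound dominates `2‖g‖² + 2L²S`, because `S ≤ (1 + S)²`.
  refine abs_le_of_sq_le_sq' (h1.trans ?_) (by positivity) |>.2
  have h4 : 0 ≤ ‖g‖ * ((1 + sumInvSq) * L) := by positivity
  nlinarith [sq_nonneg ‖g‖, sq_nonneg L, mul_nonneg (sq_nonneg L) hS,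
    mul_nonneg (sq_nonneg L) (mul_nonneg hS hS)]

end ModeCoeff

/-! ### The polynomial lift of the boundary value. -/

lemma hasDerivAt_cubic (p x : ℝ) :
    HasDerivAt (fun x : ℝ => (x ^ 3 - x) / (6 * p)) ((3 * x ^ 2 - 1) / (6 * p)) x := by
  refine (((hasDerivAt_pow 3 x).sub (hasDerivAt_id x)).div_const (6 * p)).congr_deriv ?_
  norm_num

lemma hasDerivAt_cubic_deriv (p x : ℝ) :
    HasDerivAt (fun x : ℝ => (3 * x ^ 2 - 1) / (6 * p)) (x / p) x := by
  refine ((((hasDerivAt_pow 2 x).const_mul 3).sub_const 1).div_const (6 * p)).congr_deriv ?_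
  rcases eq_or_ne p 0 with rfl | hp
  · simp
  · field_simp
    norm_num

/-- The class of `x` in `L²(0,1)`. -/
def linearL2 : L2 := toL2 (fun x => x) continuousOn_id

/-- The class of `(x³ - x) / (6p)` in `L²(0,1)`. -/
def cubicL2 (p : ℝ) : L2 := toL2 (fun x => (x ^ 3 - x) / (6 * p)) (by fun_prop)

/-- The initial value of the part with Dirichlet boundary conditions. -/
def dirichletInitial (p a b : ℝ) (u₀ : L2) : L2 := u₀ - (a • linearL2 + b • cubicL2 p)

/-- The function with boundary value `w t` at `x = 1`: a polynomial lift, where `w₁ = w'`, plus a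
sine series. -/
def liftedSeries (p : ℝ) (w w₁ : ℝ → ℝ) (c : ℕ → ℝ → ℝ) (t x : ℝ) : ℝ :=
  w t * x + w₁ t * ((x ^ 3 - x) / (6 * p)) + ∑' n, c n t * phi (n + 1) x

section LiftedSeries

variable {p : ℝ} {w w₁ w₂ : ℝ → ℝ} {g : L2}

/-- The source in the modes is the sine series of the cubic times `-w₂`, so it cancels the term `w₂
(x³ - x)/(6p)` coming from the time derivative of the lift. -/
lemma hasDerivAt_liftedSeries_time (hp : 0 < p) (hw : ∀ t, HasDerivAt w (w₁ t) t)
    (hw₁ : ∀ t, HasDerivAt w₁ (w₂ t) t) (hw₂ : Continuous w₂) {t : ℝ} (ht : 0 < t) {x : ℝ}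
    (hx : x ∈ Icc (0 : ℝ) 1) :
    HasDerivAt (fun s => liftedSeries p w w₁ (modeCoeff p g w₂) s x)
      (w₁ t * x - ∑' n, rate p n * (modeCoeff p g w₂ n t * phi (n + 1) x)) t := by
  have hb := coeffBound_modeCoeff (g := g) hp hw₂
  have h := (((hw t).mul_const x).add ((hw₁ t).mul_const ((x ^ 3 - x) / (6 * p)))).add
    (hb.hasDerivAt_tsum (fun n s _ => hasDerivAt_modeCoeff hw₂ n s) ht x)
  refine h.congr_deriv ?_
  obtain ⟨K, hK⟩ := hb.exists_bound ht
  have s1 := summable_mul_phi_of_le (fun n => (hK n).2) x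
  have hq := hasSum_cubicCoeff hp hx
  have hadd := s1.hasSum.add (hq.mul_left (w₂ t))
  have e : ∀ n, modeCoeffDeriv p g w₂ n t * phi (n + 1) x
      + w₂ t * (cubicCoeff p n * phi (n + 1) x) =
      -(rate p n * (modeCoeff p g w₂ n t * phi (n + 1) x)) := by
    intro n
    rw [modeCoeffDeriv]
    ring
  simp_rw [e] at hadd
  have h2 := hadd.tsum_eq
  rw [tsum_neg] at h2
  linear_combination -h2

lemma hasDerivAt_liftedSeries (hp : 0 < p) (hw₂ : Continuous w₂) {t : ℝ} (ht : 0 < t) (x : ℝ) :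
    HasDerivAt (liftedSeries p w w₁ (modeCoeff p g w₂) t)
      (w t + w₁ t * ((3 * x ^ 2 - 1) / (6 * p)) +
        ∑' n, modeCoeff p g w₂ n t * (Real.sqrt 2 * freq n * Real.cos (freq n * x))) x := by
  obtain ⟨K, hK⟩ := (coeffBound_modeCoeff (g := g) hp hw₂).exists_bound ht
  refine ((((hasDerivAt_id x).const_mul (w t)).add ((hasDerivAt_cubic p x).const_mul (w₁ t))).add
    (hasDerivAt_tsum_mul_phi (fun n => (hK n).1) x)).congr_deriv ?_
  rw [mul_one]

lemma hasDerivAt_liftedSeries_deriv (hp : 0 < p) (hw₂ : Continuous w₂) {t : ℝ} (ht : 0 < t)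
    (x : ℝ) :
    HasDerivAt (fun x => w t + w₁ t * ((3 * x ^ 2 - 1) / (6 * p)) +
        ∑' n, modeCoeff p g w₂ n t * (Real.sqrt 2 * freq n * Real.cos (freq n * x)))
      (w₁ t * (x / p) + ∑' n, modeCoeff p g w₂ n t * -(freq n ^ 2 * phi (n + 1) x)) x := by
  obtain ⟨K, hK⟩ := (coeffBound_modeCoeff (g := g) hp hw₂).exists_bound ht
  exact (((hasDerivAt_cubic_deriv p x).const_mul (w₁ t)).const_add (w t)).add
    (hasDerivAt_tsum_mul_phi_deriv (fun n => (hK n).1) x)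

lemma contDiff_liftedSeries (hp : 0 < p) (hw₂ : Continuous w₂) {t : ℝ} (ht : 0 < t) :
    ContDiff ℝ 2 (liftedSeries p w w₁ (modeCoeff p g w₂) t) := by
  obtain ⟨K, hK⟩ := (coeffBound_modeCoeff (g := g) hp hw₂).exists_bound ht
  have hc := continuous_tsum_mul_phi_deriv_deriv (fun n => (hK n).1)
  exact contDiff_two_of_hasDerivAt (hasDerivAt_liftedSeries hp hw₂ ht)
    (hasDerivAt_liftedSeries_deriv hp hw₂ ht) (by fun_prop)

/-- The cubic is chosen so that `p` times its second derivative is `x`; the term `w₁ x` then matches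
the one in `hasDerivAt_liftedSeries_time`. -/
lemma deriv_deriv_liftedSeries (hp : 0 < p) (hw₂ : Continuous w₂) {t : ℝ} (ht : 0 < t) (x : ℝ) :
    p * deriv (deriv (liftedSeries p w w₁ (modeCoeff p g w₂) t)) x =
      w₁ t * x - ∑' n, rate p n * (modeCoeff p g w₂ n t * phi (n + 1) x) := by
  have e : deriv (liftedSeries p w w₁ (modeCoeff p g w₂) t) = _ :=
    funext fun x => (hasDerivAt_liftedSeries hp hw₂ ht x).deriv
  rw [e, (hasDerivAt_liftedSeries_deriv hp hw₂ ht x).deriv, mul_add, ← tsum_mul_left,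
    sub_eq_add_neg, ← tsum_neg]
  congr 1
  · field_simp
  · refine tsum_congr fun n => ?_
    rw [rate]
    ring

lemma contDiffOn_liftedSeries (hp : 0 < p) (hw : ∀ t, HasDerivAt w (w₁ t) t)
    (hw₁ : ∀ t, HasDerivAt w₁ (w₂ t) t) (hw₂ : Continuous w₂) :
    ContDiffOn ℝ 1 (fun z : ℝ × ℝ => liftedSeries p w w₁ (modeCoeff p g w₂) z.1 z.2)
      (Ioi 0 ×ˢ univ) := by
  have e0 : deriv w = w₁ := funext fun t => (hw t).deriv
  have e1 : deriv w₁ = w₂ := funext fun t => (hw₁ t).deriv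
  have c0 : ContDiff ℝ 1 w := contDiff_one_iff_deriv.2
    ⟨fun t => (hw t).differentiableAt, by
      rw [e0]
      exact continuous_iff_continuousAt.2 fun t => (hw₁ t).continuousAt⟩
  have c1 : ContDiff ℝ 1 w₁ := contDiff_one_iff_deriv.2
    ⟨fun t => (hw₁ t).differentiableAt, by rwa [e1]⟩
  have hs := (coeffBound_modeCoeff (g := g) hp hw₂).contDiffOn
    (fun n s _ => hasDerivAt_modeCoeff hw₂ n s)
    fun n => (continuous_modeCoeffDeriv hw₂ n).continuousOn
  have hl : ContDiff ℝ 1 (fun z : ℝ × ℝ => w z.1 * z.2 + w₁ z.1 * ((z.2 ^ 3 - z.2) / (6 * p))) := by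
    fun_prop
  exact hl.contDiffOn.add hs

lemma liftedSeries_zero (c : ℕ → ℝ → ℝ) (t : ℝ) : liftedSeries p w w₁ c t 0 = 0 := by
  simp [liftedSeries]

lemma liftedSeries_one (c : ℕ → ℝ → ℝ) (t : ℝ) : liftedSeries p w w₁ c t 1 = w t := by
  simp [liftedSeries]

lemma coeFn_lift_add_synthesis (hp : 0 < p) (hw₂ : Continuous w₂) {t : ℝ} (ht : 0 < t) :
    (w t • linearL2 + w₁ t • cubicL2 p + synthesis (fun n => modeCoeff p g w₂ n t) : L2)
      =ᵐ[volume.restrict (Ioo (0 : ℝ) 1)] liftedSeries p w w₁ (modeCoeff p g w₂) t := by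
  obtain ⟨K, hK⟩ := (coeffBound_modeCoeff (g := g) hp hw₂).exists_bound ht
  filter_upwards [Lp.coeFn_add (w t • linearL2 + w₁ t • cubicL2 p)
      (synthesis fun n => modeCoeff p g w₂ n t),
    Lp.coeFn_add (w t • linearL2) (w₁ t • cubicL2 p), Lp.coeFn_smul (w t) linearL2,
    Lp.coeFn_smul (w₁ t) (cubicL2 p), coeFn_toL2 (fun x => x) continuousOn_id,
    coeFn_toL2 (fun x => (x ^ 3 - x) / (6 * p)) (by fun_prop),
    coeFn_synthesis (summable_modeCoeff_sq (g := g) hp hw₂ ht.le)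
      (summable_mul_phi_of_le fun n => le_div_sq_of_le_div_pow_four n (hK n).1)]
    with x h1 h2 h3 h4 h5 h6 h7
  rw [h1, Pi.add_apply, h2, Pi.add_apply, h3, h4, h7, Pi.smul_apply, Pi.smul_apply, linearL2, h5,
    cubicL2, h6]
  rfl

end LiftedSeries

/-! ### Existence for prescribed boundary data. -/

/-- The heat equation with prescribed boundary values `0` at `x = 0` and `w t` at `x = 1`. -/
lemma exists_isHeatCurve {p : ℝ} (hp : 0 < p) :
    ∃ C : ℝ, 0 < C ∧ ∀ (w w₁ w₂ : ℝ → ℝ), (∀ t, HasDerivAt w (w₁ t) t) →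
      (∀ t, HasDerivAt w₁ (w₂ t) t) → Continuous w₂ → ∀ u₀ : L2,
        ∃ (u : ℝ → ℝ → ℝ) (U : C(ℝ≥0, L2)), IsHeatCurve p u U ∧ U 0 = u₀ ∧
          (∀ t : ℝ, 0 < t → u t 1 = w t) ∧
          ∀ (t : ℝ≥0) (M : ℝ), (∀ s ∈ Icc (0 : ℝ) t, |w s| ≤ M ∧ |w₁ s| ≤ M ∧ |w₂ s| ≤ M) →
            ‖U t‖ ≤ C * (M + ‖u₀‖) := by
  set L := cubicBound p / (p * Real.pi ^ 2) with hL
  have hL0 : 0 < L := by have := cubicBound_pos hp; positivity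
  have hS : 0 ≤ sumInvSq := tsum_nonneg fun n => by positivity
  -- The lift enters three times: once in `U t`, and twice through the term `2 * ‖g‖` of
  -- `norm_synthesis_modeCoeff_le`, as `g` is `u₀` minus the lift at time `0`.
  refine ⟨2 + 3 * (‖linearL2‖ + ‖cubicL2 p‖) + 2 * (1 + sumInvSq) * L, by positivity, ?_⟩
  intro w w₁ w₂ hw hw₁ hw₂ u₀
  set g := dirichletInitial p (w 0) (w₁ 0) u₀ with hg
  set F := liftedSeries p w w₁ (modeCoeff p g w₂) with hF
  have cw : Continuous w := continuous_iff_continuousAt.2 fun t => (hw t).continuousAt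
  have cw₁ : Continuous w₁ := continuous_iff_continuousAt.2 fun t => (hw₁ t).continuousAt
  set U : C(ℝ≥0, L2) := ⟨fun t => w t • linearL2 + w₁ t • cubicL2 p +
    synthesis fun n => modeCoeff p g w₂ n t, by
      have := continuous_synthesis_modeCoeff (g := g) hp hw₂
      fun_prop⟩ with hU
  have hU0 : U 0 = u₀ := by
    simp only [hU, ContinuousMap.coe_mk, NNReal.coe_zero, modeCoeff_zero, synthesis_inner]
    rw [hg, dirichletInitial]
    abel
  have hpos : ∀ t : ℝ, 0 < t → (fun x => if t ≤ 0 then u₀ x else F t x) = F t := fun t ht => by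
    simp [not_le.2 ht]
  -- At `t = 0` the sine series of an arbitrary `L²` function need not converge pointwise, so a
  -- representative of `u₀` is used there.
  refine ⟨fun t x => if t ≤ 0 then u₀ x else F t x, U, ⟨?_, ?_, ?_, ?_, ?_⟩, hU0, ?_, ?_⟩
  · intro t
    rcases eq_or_lt_of_le (zero_le (a := t)) with rfl | ht
    · rw [hU0]
      simp
    · rw [hpos t ht]
      exact coeFn_lift_add_synthesis hp hw₂ ht
  · refine ((contDiffOn_liftedSeries (g := g) hp hw hw₁ hw₂).mono
      (prod_mono_right (subset_univ _))).congr fun z hz => ?_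
    exact congrFun (hpos z.1 hz.1) z.2
  · intro t ht
    simp only [hpos t ht]
    exact (contDiff_liftedSeries hp hw₂ ht).contDiffOn
  · intro t ht x hx
    simp only [hpos t ht]
    rw [deriv_deriv_liftedSeries hp hw₂ ht,
      ← (hasDerivAt_liftedSeries_time hp hw hw₁ hw₂ ht (Ioo_subset_Icc_self hx)).deriv]
    refine Filter.EventuallyEq.deriv_eq ?_
    filter_upwards [Ioi_mem_nhds ht] with s hs using congrFun (hpos s hs) x
  · intro t ht
    exact (congrFun (hpos t ht) 0).trans (liftedSeries_zero _ _)
  · intro t ht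
    exact (congrFun (hpos t ht) 1).trans (liftedSeries_one _ _)
  · intro t M hM
    have h0 := hM 0 ⟨le_rfl, t.coe_nonneg⟩
    have ht := hM t ⟨t.coe_nonneg, le_rfl⟩
    have hM0 : 0 ≤ M := (abs_nonneg _).trans h0.1
    have hlift : ∀ a b : ℝ, |a| ≤ M → |b| ≤ M →
        ‖a • linearL2 + b • cubicL2 p‖ ≤ M * (‖linearL2‖ + ‖cubicL2 p‖) := by
      intro a b ha hb
      refine (norm_add_le _ _).trans ?_
      rw [norm_smul, norm_smul, mul_add]
      gcongr <;> assumption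
    have h1 := hlift _ _ ht.1 ht.2.1
    have h2 : ‖g‖ ≤ ‖u₀‖ + M * (‖linearL2‖ + ‖cubicL2 p‖) :=
      (norm_sub_le _ _).trans (by gcongr; exact hlift _ _ h0.1 h0.2.1)
    have h3 := norm_synthesis_modeCoeff_le (g := g) hp hw₂ t.coe_nonneg fun s hs => (hM s hs).2.2
    have h4 : ‖U t‖ ≤ _ := norm_add_le _ _
    refine h4.trans ?_
    have h5 : 0 ≤ (3 * (‖linearL2‖ + ‖cubicL2 p‖) + 2 * (1 + sumInvSq) * L) * ‖u₀‖ := by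
      positivity
    simp only [← hL] at h3
    linarith

/-! ### Closing the feedback loop. -/

/-- The linear functional `y ↦ ∑ κ i * y i`. -/
def feedback {N : ℕ} (κ : Fin N → ℝ) : (Fin N → ℝ) →L[ℝ] ℝ :=
  ∑ j, κ j • ContinuousLinearMap.proj j

lemma feedback_apply {N : ℕ} (κ y : Fin N → ℝ) : feedback κ y = ∑ j, κ j * y j := by
  simp [feedback]

lemma exists_isSolution {p : ℝ} (hp : 0 < p) {N : ℕ} (κ : Fin N → ℝ) :
    ∃ Q σ : ℝ, 0 < Q ∧ 0 < σ ∧ ∀ u₀ : L2, ∃ (u : ℝ → ℝ → ℝ) (U : C(ℝ≥0, L2)),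
      IsSolution p (kernel κ) u₀ u U ∧ ∀ t : ℝ≥0, ‖U t‖ ≤ Q * Real.exp (σ * t) * ‖u₀‖ := by
  obtain ⟨C, hC, hex⟩ := exists_isHeatCurve hp
  set A := modalOp p κ
  -- The factor `(1 + ‖A‖)²` dominates `1`, `‖A‖` and `‖A‖²`, hence serves `w`, `w'` and `w''` at
  -- once.
  set K := ‖feedback κ‖ * (1 + ‖A‖) ^ 2 with hK
  have hK0 : 0 ≤ K := by positivity
  -- The growth rate is `‖A‖`; adding `1` keeps `σ` positive even when `A = 0`.
  refine ⟨C * (K + 1), ‖A‖ + 1, by positivity, by positivity, fun u₀ => ?_⟩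
  set a : Fin N → ℝ := fun i => inner ℝ (sineL2 i) u₀
  set y : ℝ → Fin N → ℝ := fun t => NormedSpace.exp (t • A) a with hy
  have hd : ∀ t, HasDerivAt y (A (y t)) t := hasDerivAt_exp_smul_apply A a
  have hyc : Continuous y := continuous_iff_continuousAt.2 fun t => (hd t).continuousAt
  have ha : ‖a‖ ≤ ‖u₀‖ := (pi_norm_le_iff_of_nonneg (norm_nonneg _)).2 fun i =>
    abs_inner_sineL2_le i u₀
  obtain ⟨u, U, hu, hU0, hbc, hbound⟩ := hex (fun t => feedback κ (y t))
    (fun t => feedback κ (A (y t))) (fun t => feedback κ (A (A (y t))))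
    (fun t => (feedback κ).hasFDerivAt.comp_hasDerivAt t (hd t))
    (fun t => (feedback κ ∘L A).hasFDerivAt.comp_hasDerivAt t (hd t)) (by fun_prop) u₀
  -- Consistency of the loop: the boundary value was prescribed from `y`, so the coordinates of `U`
  -- and those of `y` solve the same scalar equations with the same forcing and initial values.
  have hcoord : ∀ i : Fin N, ∀ t : ℝ, 0 < t → coord U i t = y t i := by
    intro i t ht
    refine sub_eq_zero.1 (eq_zero_of_hasDerivAt_mul (l := -rate p i)
      (y := fun t => coord U i t - y t i)
      ((continuous_coord U i).sub ((continuous_apply i).comp hyc)).continuousAt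
      (by simp [coord_zero, hU0, hy, a]) (fun s hs => ?_) ht)
    refine ((hu.hasDerivAt_coord i hs).sub (hasDerivAt_pi.1 (hd s) i)).congr_deriv ?_
    rw [hbc s hs, modalOp_apply, feedback_apply]
    ring
  refine ⟨u, U, ⟨hu.profile, hu.contDiffOn_one, hu.contDiffOn_two, hu.heat, hu.left_bc,
    fun t ht => ?_, hU0⟩, fun t => ?_⟩
  · rw [hbc t ht, hu.integral_kernel_mul κ ht, feedback_apply]
    exact Finset.sum_congr rfl fun i _ => by rw [hcoord i t ht]
  · have hE : 1 ≤ Real.exp (‖A‖ * t) := Real.one_le_exp (by positivity)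
    have hys : ∀ s ∈ Icc (0 : ℝ) t, ‖y s‖ ≤ Real.exp (‖A‖ * t) * ‖u₀‖ := fun s hs => by
      refine (norm_exp_smul_apply_le A a hs.1).trans ?_
      rw [mul_comm]
      gcongr
      exact hs.2
    have hA : 1 ≤ 1 + ‖A‖ := by linarith [norm_nonneg A]
    have hle : ∀ (s : ℝ) (z : Fin N → ℝ), s ∈ Icc (0 : ℝ) t → ‖z‖ ≤ (1 + ‖A‖) ^ 2 * ‖y s‖ →
        |feedback κ z| ≤ K * Real.exp (‖A‖ * t) * ‖u₀‖ := by
      intro s z hs hz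
      calc |feedback κ z| ≤ ‖feedback κ‖ * ‖z‖ := (feedback κ).le_opNorm z
        _ ≤ ‖feedback κ‖ * ((1 + ‖A‖) ^ 2 * (Real.exp (‖A‖ * t) * ‖u₀‖)) := by
            gcongr
            exact hz.trans (by gcongr; exact hys s hs)
        _ = _ := by rw [hK]; ring
    have h1 := hbound t (K * Real.exp (‖A‖ * t) * ‖u₀‖) fun s hs => by
      have n1 := A.le_opNorm (y s)
      have n2 := A.le_opNorm (A (y s))
      have n0 := norm_nonneg (y s)
      have n3 := mul_le_mul_of_nonneg_left n1 (norm_nonneg A)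
      have m1 := mul_nonneg (norm_nonneg A) n0
      have m2 := mul_nonneg (norm_nonneg A) m1
      refine ⟨hle s _ hs ?_, hle s _ hs ?_, hle s _ hs ?_⟩
      · linarith
      · linarith
      · linarith
    refine h1.trans ?_
    calc C * (K * Real.exp (‖A‖ * t) * ‖u₀‖ + ‖u₀‖)
        ≤ C * (K * Real.exp (‖A‖ * t) * ‖u₀‖ + Real.exp (‖A‖ * t) * ‖u₀‖) := by
          gcongr
          exact le_mul_of_one_le_left (norm_nonneg _) hE
      _ = C * (K + 1) * Real.exp (‖A‖ * t) * ‖u₀‖ := by ring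
      _ ≤ C * (K + 1) * Real.exp ((‖A‖ + 1) * t) * ‖u₀‖ := by
          gcongr
          linarith

end HeatFeedback

end

theorem theorem5p1 (p : ℝ) (hp : 0 < p) (N : ℕ) (hN : 1 ≤ N) (κ : Fin N → ℝ) :
    ∃ Q σ : ℝ, 0 < Q ∧ 0 < σ ∧
      ∀ u₀ : HeatFeedback.L2,
        ∃ (u : ℝ → ℝ → ℝ) (U : C(ℝ≥0, HeatFeedback.L2)),
          HeatFeedback.IsSolution p (HeatFeedback.kernel κ) u₀ u U ∧
          (∀ (v : ℝ → ℝ → ℝ) (V : C(ℝ≥0, HeatFeedback.L2)),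
            HeatFeedback.IsSolution p (HeatFeedback.kernel κ) u₀ v V →
              V = U ∧ ∀ t : ℝ, 0 < t → ∀ x ∈ Icc (0 : ℝ) 1, v t x = u t x) ∧
          ∀ t : ℝ≥0, ‖U t‖ ≤ Q * Real.exp (σ * t) * ‖u₀‖ := by
  obtain ⟨Q, σ, hQ, hσ, h⟩ := HeatFeedback.exists_isSolution hp κ
  refine ⟨Q, σ, hQ, hσ, fun u₀ => ?_⟩
  obtain ⟨u, U, hu, hb⟩ := h u₀
  exact ⟨u, U, hu, fun v V hv => hv.unique hu, hb⟩
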